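/- Let $n\ge 2$, $K\ge 0$ and let $W_0,\dots,W_K\ge 1$ be integers (contention windows) with $W_s\le W_K$ for all $s$ and $W_K\ge 2$. For $\beta_d,\beta_c\in[1/W_K,1]$, an integer $w\ge 1$ and $r\in[0,1]$ (with $0^0=1$) put $$I(w,r)=\frac1w\sum_{l=1}^{w}(1-r^{l-1}),\qquad R(w,r)=\frac1w\sum_{l=1}^{w}\sum_{v=1}^{l-1}(l-v)r^{v-1}(1-r),$$ $$F(w,r)=\frac1w\sum_{l=1}^{w}\Big[l\,r^{l-1}+\sum_{v=1}^{l-1}v\,r^{v-1}(1-r)\Big],$$ $$r_a=(1-\beta_c)^{a-1}(1-\beta_d)^{n-a}\ (1\le a\le n),\qquad \beta_s=\frac{1-I(W_0,r_*)}{F(W_0,r_*)},\quad r_*=(1-\beta_d)^{n-1}.$$ Consider the following Markov chain, embedded at the starts of the transmission cycles of a system of $n$ saturated nodes with negligible propagation delay. Its states are triples $(s,a,b)$: $s\in\{0,\dots,K\}$ is the backoff stage of a tagged node, $a\in\{1,\dots,n\}$ is the number of nodes that attempted in the transmission cycle just concluded, and $b$ is the residual backoff of the tagged node, where $b=0$ means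 that the tagged node itself attempted. The states are $(0,1,0)$; $(s,a,0)$ with $2\le a\le n$; and $(s,a,b)$ with $1\le a\le n-1$, $1\le b\le W_s-1$. From $(s,a,0)$ the tagged node samples its backoff $l$ uniformly from $\{1,\dots,W_s\}$, while $a-1$ of the other nodes attempt in each slot with probability $\beta_c$ and the remaining $n-a$ with probability $\beta_d$. From $(s,a,b)$ with $b>0$ the tagged node has $l=b$ slots to count, while $a$ of the other nodes attempt in each slot with probability $\beta_s$ (if $a=1$) or $\beta_c$ (if $a\ge2$), and the remaining $n-1-a$ with probability $\beta_d$. All attempts of the other nodes in the slots, and the sampled backoff, are independent. If no other node attempts in slots $1,\dots,l$, the next state is $(0,1,0)$. If the first attempt of the others takes place in slot $l$, by $a'-1\ge 1$ of them, the next state is $((s+1)\bmod (K+1),a',0)$. If it takes place in a slot $t<l$, by $a'\ge1$ of them, the next state is $(s,a',l-t)$. The backoff-cycle chain is this chain observed only at its visits to states with $b=0$; it is regarded as a chain on the pairs $(s,a)\in\{0,\dots,K\}\times\{1,\dots,n\}$, where the formulas above define the transitions from all pairs. Then there is a point $(\beta_d,\beta_c)\in \mathbf C=[1/W_K,1]\times[1/W_K,1]$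 such that, for these rates, the first chain has a unique stationary distribution $\phi$, the backoff-cycle chain has a unique stationary distribution $\psi$, $\psi(s,a)=\phi(s,a,0)/\sum_{s',a'}\phi(s',a',0)$ (where $\phi$ is $0$ off the state space, and the denominator is positive), and the fixed-point equations $$\beta_d=\frac{\sum_{(s,a)}\psi(s,a)\,I(W_s,r_a)}{\sum_{(s,a)}\psi(s,a)\,R(W_s,r_a)},\qquad \beta_c=\frac{\sum_{(s,a)\ne(0,1)}\psi(s,a)\,(1-I(W_s,r_a))}{\sum_{(s,a)\ne(0,1)}\psi(s,a)\,F(W_s,r_a)}$$ hold, with positive denominators, as is that of $\beta_s$. -/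

import Mathlib

/-! ### Finite Markov chains -/

/-- `π` is a stationary distribution of the Markov chain with finite state space `S` and one-step
transition probabilities `P x y`. The function `π` is extended by `0` outside `S`. -/
structure IsStationaryDist {α : Type} (S : Finset α) (P : α → α → ℝ) (π : α → ℝ) : Prop where
  nonneg : ∀ x ∈ S, 0 ≤ π x
  eq_zero : ∀ x, x ∉ S → π x = 0
  sum_eq_one : ∑ x ∈ S, π x = 1
  balance : ∀ y ∈ S, ∑ x ∈ S, π x * P x y = π y

/-- `π` is the only stationary distribution of the chain `(S, P)`. -/
def IsUniqueStationaryDist {α : Type} (S : Finset α) (P : α → α → ℝ) (π : α → ℝ) : Prop :=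
  IsStationaryDist S P π ∧ ∀ π₂ : α → ℝ, IsStationaryDist S P π₂ → π₂ = π

/-! ### One backoff cycle with uniform backoff

In the next three definitions `w` is the contention window of the tagged node and `r` is the
probability that all the other nodes stay silent in a given backoff slot. -/

/-- Probability that the tagged node, which samples its backoff `l` uniformly from `{1, …, w}`,
is interrupted, i.e. that another node attempts within the first `l - 1` slots. -/
noncomputable def interruptProb (w : ℕ) (r : ℝ) : ℝ :=
  (1 / (w : ℝ)) * ∑ l ∈ Finset.Icc 1 w, (1 - r ^ (l - 1))

/-- Mean residual backoff of the tagged node from its first interruption to the completion of its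
backoff (the residual backoff is `0` if there is no interruption). -/
noncomputable def meanResidual (w : ℕ) (r : ℝ) : ℝ :=
  (1 / (w : ℝ)) * ∑ l ∈ Finset.Icc 1 w, ∑ v ∈ Finset.Icc 1 (l - 1),
    ((l : ℝ) - (v : ℝ)) * r ^ (v - 1) * (1 - r)

/-- Mean backoff counted by the tagged node until it is interrupted or completes its backoff,
whichever is earlier. -/
noncomputable def meanFirst (w : ℕ) (r : ℝ) : ℝ :=
  (1 / (w : ℝ)) * ∑ l ∈ Finset.Icc 1 w,
    ((l : ℝ) * r ^ (l - 1) + ∑ v ∈ Finset.Icc 1 (l - 1), (v : ℝ) * r ^ (v - 1) * (1 - r))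

/-- Probability that the `n - 1` other nodes are silent in a slot of the first transmission cycle
of a backoff cycle that starts after `na` nodes attempted together, the tagged one included. -/
noncomputable def quietProb (n : ℕ) (βd βc : ℝ) (na : ℕ) : ℝ :=
  (1 - βc) ^ (na - 1) * (1 - βd) ^ (n - na)

/-- The attempt rate `β_s` after a success, a function of `β_d` alone. -/
noncomputable def rateS (n : ℕ) (W : ℕ → ℕ) (βd : ℝ) : ℝ :=
  (1 - interruptProb (W 0) ((1 - βd) ^ (n - 1))) / meanFirst (W 0) ((1 - βd) ^ (n - 1))

/-! ### The auxiliary chain, embedded at the starts of the transmission cycles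

A state is a triple `(s, na, b)`: the backoff stage `s` of the tagged node, the number `na` of nodes
that attempted in the transmission cycle just concluded, and the residual backoff `b` of the tagged
node; `b = 0` means that the tagged node attempted itself (and samples a fresh backoff). -/

/-- The state space: stages `0, …, K`; a tagged node that has just attempted alone was successful
and is in stage `0`; an interrupted tagged node is not among the attempting ones, and its residual
backoff is at most `W s - 1`. -/
def auxStates (n K : ℕ) (W : ℕ → ℕ) : Finset (ℕ × ℕ × ℕ) :=
  (Finset.range (K + 1) ×ˢ Finset.Icc 1 n ×ˢ Finset.range (W K + 1)).filter fun x =>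
    (x.2.2 = 0 → x.2.1 = 1 → x.1 = 0) ∧ (0 < x.2.2 → x.2.1 < n ∧ x.2.2 < W x.1)

/-- Of the `n - 1` other nodes, `x` attempt with probability `βx` in each slot and `n - 1 - x` with
probability `βd`, independently. This is the probability that exactly `y` of them attempt in the
slot `t ≥ 1`, and that there is no other attempt in the slots `1, …, t`. -/
noncomputable def jointProb (n x : ℕ) (βx βd : ℝ) (y t : ℕ) : ℝ :=
  ∑ p ∈ (Finset.range (x + 1) ×ˢ Finset.range (n - 1 - x + 1)).filter (fun p => p.1 + p.2 = y),
    ((1 - βx) ^ (t - 1) * βx) ^ p.1 * ((1 - βd) ^ (t - 1) * βd) ^ p.2 *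
      (x.choose p.1 : ℝ) * (1 - βx) ^ (t * (x - p.1)) *
      ((n - 1 - x).choose p.2 : ℝ) * (1 - βd) ^ (t * (n - 1 - x - p.2))

/-- Probability that a transmission cycle ends in the state `(s₂, na₂, b₂)` if the tagged node is in
stage `s` with a remaining count of `l ≥ 1` slots, and `x` of the others attempt at rate `βx`, the
rest at rate `βd`. The cases are: success of the tagged node after `l` slots; collision in slot `l`
with `na₂ - 1` others (the stage `K` is followed by the stage `0`); interruption by `na₂` others in
slot `l - b₂`. -/
noncomputable def countdownProb (n K x : ℕ) (βx βd : ℝ) (s l : ℕ) : ℕ × ℕ × ℕ → ℝ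
  | (s₂, na₂, b₂) =>
    if b₂ = 0 then
      if s₂ = 0 ∧ na₂ = 1 then (1 - βd) ^ (l * (n - 1 - x)) * (1 - βx) ^ (l * x)
      else if s₂ = (s + 1) % (K + 1) ∧ 2 ≤ na₂ ∧ na₂ ≤ n then jointProb n x βx βd (na₂ - 1) l
      else 0
    else if s₂ = s ∧ 1 ≤ na₂ ∧ na₂ ≤ n - 1 ∧ b₂ < l then jointProb n x βx βd na₂ (l - b₂)
    else 0

/-- Transition probabilities of the auxiliary chain. After an attempt of the tagged node
(`b = 0`), it samples its backoff uniformly from `{1, …, W s}`, the `na - 1` others that attempted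
with it use the rate `βc` and the remaining `n - na` nodes the rate `βd`. After an interruption by
`na` others, it resumes its residual backoff `b`, those `na` nodes use `β_s` if `na = 1` and `βc`
otherwise, and the remaining `n - 1 - na` nodes use `βd`. -/
noncomputable def auxKernel (n K : ℕ) (W : ℕ → ℕ) (βd βc : ℝ) : ℕ × ℕ × ℕ → ℕ × ℕ × ℕ → ℝ
  | (s, na, b), y =>
    if b = 0 then
      (1 / (W s : ℝ)) * ∑ l ∈ Finset.Icc 1 (W s), countdownProb n K (na - 1) βc βd s l y
    else
      countdownProb n K na (if na = 1 then rateS n W βd else βc) βd s b y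

/-! ### The backoff-cycle chain of the tagged node, embedded after its own attempts -/

/-- States `(s, na)`: the new backoff stage of the tagged node, and the number of nodes (itself
included) that attempted in the transmission cycle just concluded. -/
def cycleStates (n K : ℕ) : Finset (ℕ × ℕ) :=
  Finset.range (K + 1) ×ˢ Finset.Icc 1 n

/-- Probability that the auxiliary chain, started in `x`, makes exactly `k` steps into states in
which the tagged node is interrupted, and then a step into the state `(y, 0)`, in which the tagged
node has attempted. -/
noncomputable def returnProb (n K : ℕ) (W : ℕ → ℕ) (βd βc : ℝ) :
    ℕ → ℕ × ℕ × ℕ → ℕ × ℕ → ℝ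
  | 0, x, y => auxKernel n K W βd βc x (y.1, y.2, 0)
  | k + 1, x, y =>
    ∑ z ∈ (auxStates n K W).filter (fun z => 0 < z.2.2),
      auxKernel n K W βd βc x z * returnProb n K W βd βc k z y

/-- Transition probabilities of the backoff-cycle chain. The residual backoff is less than `W K` at
the first interruption and decreases at each further one, so that there are fewer than `W K`
interruptions in a backoff cycle. -/
noncomputable def cycleKernel (n K : ℕ) (W : ℕ → ℕ) (βd βc : ℝ) (x y : ℕ × ℕ) : ℝ :=
  ∑ k ∈ Finset.range (W K), returnProb n K W βd βc k (x.1, x.2, 0) y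

/-! ### The fixed-point equations -/

/-- `(βd, βc)` solves the fixed-point equations for the attempt rates. Here `φ` is the stationary
distribution of the auxiliary chain with the rates `βd`, `βc` and `β_s = rateS n W βd`, and `ψ` is
the stationary distribution of the backoff-cycle chain with these rates; that all of these are well
defined (uniqueness, positive denominators) is part of the claim. -/
structure SolvesFixedPoint (n K : ℕ) (W : ℕ → ℕ) (βd βc : ℝ)
    (φ : ℕ × ℕ × ℕ → ℝ) (ψ : ℕ × ℕ → ℝ) : Prop where
  aux_stationary : IsUniqueStationaryDist (auxStates n K W) (auxKernel n K W βd βc) φ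
  cycle_stationary : IsUniqueStationaryDist (cycleStates n K) (cycleKernel n K W βd βc) ψ
  aux_pos : 0 < ∑ y ∈ cycleStates n K, φ (y.1, y.2, 0)
  cycle_eq : ∀ x ∈ cycleStates n K,
    ψ x = φ (x.1, x.2, 0) / ∑ y ∈ cycleStates n K, φ (y.1, y.2, 0)
  s_pos : 0 < meanFirst (W 0) ((1 - βd) ^ (n - 1))
  d_pos : 0 < ∑ x ∈ cycleStates n K, ψ x * meanResidual (W x.1) (quietProb n βd βc x.2)
  d_eq : βd =
    (∑ x ∈ cycleStates n K, ψ x * interruptProb (W x.1) (quietProb n βd βc x.2)) /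
      ∑ x ∈ cycleStates n K, ψ x * meanResidual (W x.1) (quietProb n βd βc x.2)
  c_pos : 0 < ∑ x ∈ (cycleStates n K).erase (0, 1),
    ψ x * meanFirst (W x.1) (quietProb n βd βc x.2)
  c_eq : βc =
    (∑ x ∈ (cycleStates n K).erase (0, 1),
        ψ x * (1 - interruptProb (W x.1) (quietProb n βd βc x.2))) /
      ∑ x ∈ (cycleStates n K).erase (0, 1),
        ψ x * meanFirst (W x.1) (quietProb n βd βc x.2)

/-! The right-hand sides of the two fixed-point equations form a continuous map of the square `[1 /
W K, 1]²` into itself, and Brouwer's theorem in the plane supplies the fixed point.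

Continuity. For positive rates all others may attempt in the very next slot, with positive
probability even if the rates equal 1. Repeating this uses up any residual backoff and then advances
the tagged node through the stages, so `(K, n, 0)` is reachable from every state. A finite chain
with such a state has one stationary distribution, which is obtained from an invertible linear
system and so varies continuously with the kernel (`exists_continuous_stationaryDist`). Residual
backoffs strictly decrease within a backoff cycle. Unrolling the balance equations therefore
terminates and shows that `φ` conditioned on `b = 0` is stationary for the backoff-cycle chain
(`balance_returnProb`, `cycle_isStationaryDist`); thus `ψ` is continuous as well.

Invariance. For a window `w` and a quiet probability in `[0, 1]`, `I ≤ R ≤ w I` and `1 - I ≤ F ≤ w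
(1 - I)`. Every `ψ`-weighted ratio then lies in `[1 / W K, 1]`, provided that its denominator is
positive; the state `(K, n)` ensures this, since it has positive mass and `W K ≥ 2`.

Brouwer's theorem is derived from the Poincaré–Miranda theorem: a nowhere vanishing map would have a
continuous argument on the rectangle, but the boundary signs force this argument to gain a full turn
around the boundary. -/

/-! ### Fixed points in a planar rectangle -/

open Set in
/-- A nowhere vanishing continuous function on a compact convex set has a continuous logarithm. -/
theorem exists_continuousOn_log {E : Type*} [NormedAddCommGroup E] [NormedSpace ℝ E] {s : Set E}
    (hs : IsCompact s) (hconv : Convex ℝ s) {g : E → ℂ} (hg : ContinuousOn g s)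
    (hne : ∀ x ∈ s, g x ≠ 0) :
    ∃ L : E → ℂ, ContinuousOn L s ∧ ∀ x ∈ s, Complex.exp (L x) = g x := by
  rcases s.eq_empty_or_nonempty with rfl | ⟨x₀, hx₀⟩
  · exact ⟨0, by simp, by simp⟩
  obtain ⟨xm, hxm, hmin⟩ := hs.exists_isMinOn ⟨x₀, hx₀⟩ hg.norm
  have hε : 0 < ‖g xm‖ := norm_pos_iff.2 (hne _ hxm)
  obtain ⟨δ, hδ, hδg⟩ := Metric.uniformContinuousOn_iff.1
    (hs.uniformContinuousOn_of_continuous hg) _ hε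
  obtain ⟨D, hD⟩ := hs.isBounded.subset_closedBall x₀
  obtain ⟨N, hN⟩ := exists_nat_gt (max 0 (D / δ))
  have hN0 : (0 : ℝ) < N := (le_max_left _ _).trans_lt hN
  have hND : D < N * δ := (div_lt_iff₀ hδ).1 ((le_max_right _ _).trans_lt hN)
  -- The points `p k x` cut the segment from `x₀` to `x` into `N` steps shorter than `δ`. As `δ`
  -- belongs to the minimum of `‖g‖` on `s`, consecutive values of `g` have a ratio at distance less
  -- than one from 1, where the principal logarithm is continuous. The product of the ratios
  -- telescopes.
  let p : ℕ → E → E := fun k x => x₀ + ((k : ℝ) / N) • (x - x₀)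
  have hpc : ∀ k, Continuous (p k) := fun k => by fun_prop
  have hps : ∀ k ≤ N, MapsTo (p k) s s := fun k hk x hx =>
    hconv.add_smul_sub_mem hx₀ hx ⟨by positivity, (div_le_one hN0).2 (by exact_mod_cast hk)⟩
  have hpd : ∀ k x, x ∈ s → dist (p (k + 1) x) (p k x) < δ := by
    intro k x hx
    have : p (k + 1) x - p k x = (1 / (N : ℝ)) • (x - x₀) := by
      simp only [p, add_sub_add_left_eq_sub, ← sub_smul]
      congr 1
      push_cast
      ring
    rw [dist_eq_norm, this, norm_smul, Real.norm_of_nonneg (by positivity), one_div_mul_eq_div,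
      div_lt_iff₀ hN0, mul_comm, ← dist_eq_norm]
    exact (hD hx).trans_lt hND
  have hslit : ∀ k < N, ∀ x ∈ s, g (p (k + 1) x) / g (p k x) ∈ Complex.slitPlane := by
    intro k hk x hx
    have h1 := hps k hk.le hx
    have h2 := hps (k + 1) hk hx
    have h3 : ‖g (p (k + 1) x) / g (p k x) - 1‖ < 1 := by
      rw [div_sub_one (hne _ h1), norm_div, div_lt_one (norm_pos_iff.2 (hne _ h1)),
        ← dist_eq_norm]
      exact (hδg _ h2 _ h1 (hpd k x hx)).trans_le (hmin h1)
    have := Complex.mem_slitPlane_of_norm_lt_one h3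
    simpa using this
  refine ⟨fun x => Complex.log (g x₀) +
    ∑ k ∈ Finset.range N, Complex.log (g (p (k + 1) x) / g (p k x)), ?_, fun x hx => ?_⟩
  · refine continuousOn_const.add (continuousOn_finsetSum _ fun k hk => ?_)
    have hk := Finset.mem_range.1 hk
    refine ContinuousOn.clog (ContinuousOn.div ?_ ?_ fun x hx => hne _ (hps k hk.le hx))
      (hslit k hk)
    · exact hg.comp (hpc _).continuousOn (hps _ hk)
    · exact hg.comp (hpc _).continuousOn (hps _ hk.le)
  · have key : ∀ m ≤ N, Complex.exp (Complex.log (g x₀) +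
        ∑ k ∈ Finset.range m, Complex.log (g (p (k + 1) x) / g (p k x))) = g (p m x) := by
      intro m
      induction m with
      | zero => intro; simp [p, Complex.exp_log (hne _ hx₀)]
      | succ m ih =>
        intro hm
        have h1 := hne _ (hps m (by omega) hx)
        have h2 := hne _ (hps (m + 1) hm hx)
        rw [Finset.sum_range_succ, ← add_assoc, Complex.exp_add, ih (by omega),
          Complex.exp_log (div_ne_zero h2 h1), mul_div_cancel₀ _ h1]
    rw [key N le_rfl]
    simp [p, hN0.ne']

/-- A continuous angle on an interval cannot leave the half-turn `[c - π, c]` if it avoids the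
angles with `0 < sin (θ - c)`. -/
theorem angle_mem_Icc_of_sin_nonpos {I : Set ℝ} (hI : IsPreconnected I) {θ : ℝ → ℝ}
    (hθ : ContinuousOn θ I) {c : ℝ} (hsin : ∀ t ∈ I, Real.sin (θ t - c) ≤ 0) {t u : ℝ}
    (ht : t ∈ I) (hu : u ∈ I) (h : θ t ∈ Set.Icc (c - Real.pi) c) :
    θ u ∈ Set.Icc (c - Real.pi) c := by
  have hoc := (hI.image θ hθ).ordConnected
  have hpi := Real.pi_pos
  have key : ∀ y ∈ Set.uIcc (θ t) (θ u), Real.sin (y - c) ≤ 0 := by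
    intro y hy
    obtain ⟨v, hv, rfl⟩ := hoc.uIcc_subset ⟨t, ht, rfl⟩ ⟨u, hu, rfl⟩ hy
    exact hsin v hv
  constructor
  -- The attained angles form an interval. If they went below `c - π`, they would include a point of
  -- `[c - 3π/2, c - π)`, where the sine is positive; the maximum selects one. The other side is
  -- analogous.
  · by_contra! hlt
    have hlt' : max (θ u) (c - 3 * Real.pi / 2) < c - Real.pi :=
      max_lt hlt (by linarith)
    have h1 := key (max (θ u) (c - 3 * Real.pi / 2))
      (Set.mem_uIcc.2 (Or.inr ⟨le_max_left _ _, hlt'.le.trans h.1⟩))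
    have h2 : c - 3 * Real.pi / 2 ≤ max (θ u) (c - 3 * Real.pi / 2) := le_max_right _ _
    have h3 := Real.sin_pos_of_pos_of_lt_pi
      (x := max (θ u) (c - 3 * Real.pi / 2) - c + 2 * Real.pi) (by linarith) (by linarith)
    rw [Real.sin_add_two_pi] at h3
    linarith
  · by_contra! hlt
    have hlt' : c < min (θ u) (c + Real.pi / 2) := lt_min hlt (by linarith)
    have h1 := key (min (θ u) (c + Real.pi / 2))
      (Set.mem_uIcc.2 (Or.inl ⟨h.2.trans hlt'.le, min_le_left _ _⟩))
    have h2 : min (θ u) (c + Real.pi / 2) ≤ c + Real.pi / 2 := min_le_right _ _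
    have h3 := Real.sin_pos_of_pos_of_lt_pi
      (x := min (θ u) (c + Real.pi / 2) - c) (by linarith) (by linarith)
    linarith

open Set in
/-- The Poincaré–Miranda theorem in dimension two. -/
theorem exists_zero_of_boundary_signs {a b c d : ℝ} (hab : a ≤ b) (hcd : c ≤ d)
    {g : ℝ × ℝ → ℂ} (hg : ContinuousOn g (Icc a b ×ˢ Icc c d))
    (hleft : ∀ y ∈ Icc c d, (g (a, y)).re ≤ 0) (hright : ∀ y ∈ Icc c d, 0 ≤ (g (b, y)).re)
    (hbot : ∀ x ∈ Icc a b, (g (x, c)).im ≤ 0) (htop : ∀ x ∈ Icc a b, 0 ≤ (g (x, d)).im) :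
    ∃ p ∈ Icc a b ×ˢ Icc c d, g p = 0 := by
  by_contra! hne
  obtain ⟨L, hL, hexp⟩ := exists_continuousOn_log (isCompact_Icc.prod isCompact_Icc)
    ((convex_Icc a b).prod (convex_Icc c d)) hg hne
  have ha : a ∈ Icc a b := left_mem_Icc.2 hab
  have hb : b ∈ Icc a b := right_mem_Icc.2 hab
  have hc : c ∈ Icc c d := left_mem_Icc.2 hcd
  have hd : d ∈ Icc c d := right_mem_Icc.2 hcd
  have hpi := Real.pi_pos
  -- The branch of the argument is fixed by requiring that the corner `(a, c)` have its angle in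
  -- `[-π, π)`.
  obtain ⟨m, hm, -⟩ := existsUnique_sub_zsmul_mem_Ico Real.two_pi_pos (L (a, c)).im (-Real.pi)
  set θ : ℝ × ℝ → ℝ := fun p => (L p).im - m • (2 * Real.pi) with hθdef
  have hθ : ContinuousOn θ (Icc a b ×ˢ Icc c d) :=
    (Complex.continuous_im.comp_continuousOn hL).sub continuousOn_const
  have hre : ∀ p ∈ Icc a b ×ˢ Icc c d, (g p).re = Real.exp (L p).re * Real.cos (θ p) := by
    intro p hp
    rw [← hexp p hp, Complex.exp_re, hθdef]
    simp only [zsmul_eq_mul, Real.cos_sub_int_mul_two_pi]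
  have him : ∀ p ∈ Icc a b ×ˢ Icc c d, (g p).im = Real.exp (L p).re * Real.sin (θ p) := by
    intro p hp
    rw [← hexp p hp, Complex.exp_im, hθdef]
    simp only [zsmul_eq_mul, Real.sin_sub_int_mul_two_pi]
  have cleft : ∀ y ∈ Icc c d, Real.cos (θ (a, y)) ≤ 0 := fun y hy => by
    have := hleft y hy
    rw [hre _ ⟨ha, hy⟩] at this
    exact nonpos_of_mul_nonpos_right this (Real.exp_pos _)
  have cright : ∀ y ∈ Icc c d, 0 ≤ Real.cos (θ (b, y)) := fun y hy => by
    have := hright y hy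
    rw [hre _ ⟨hb, hy⟩] at this
    exact nonneg_of_mul_nonneg_right this (Real.exp_pos _)
  have sbot : ∀ x ∈ Icc a b, Real.sin (θ (x, c)) ≤ 0 := fun x hx => by
    have := hbot x hx
    rw [him _ ⟨hx, hc⟩] at this
    exact nonpos_of_mul_nonpos_right this (Real.exp_pos _)
  have snonneg_top : ∀ x ∈ Icc a b, 0 ≤ Real.sin (θ (x, d)) := fun x hx => by
    have := htop x hx
    rw [him _ ⟨hx, hd⟩] at this
    exact nonneg_of_mul_nonneg_right this (Real.exp_pos _)
  have hor : ∀ y ∈ Icc c d, ContinuousOn (fun x => θ (x, y)) (Icc a b) := fun y hy =>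
    hθ.comp (by fun_prop) fun x hx => ⟨hx, hy⟩
  have ver : ∀ x ∈ Icc a b, ContinuousOn (fun y => θ (x, y)) (Icc c d) := fun x hx =>
    hθ.comp (by fun_prop) fun y hy => ⟨hx, hy⟩
  -- Counterclockwise around the boundary, each edge confines the angle to a half-turn and each
  -- corner to a quarter-turn: `[-π, -π/2]`, `[-π/2, 0]`, `[0, π/2]`, `[π/2, π]`. Back at `(a, c)`
  -- along the left edge the angle is at least `π/2`, a contradiction.
  have h0 : θ (a, c) ∈ Icc (0 - Real.pi) 0 := by
    refine ⟨by rw [zero_sub]; exact hm.1, ?_⟩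
    by_contra! hlt
    have h2 : θ (a, c) < Real.pi := by have := hm.2; simp only [hθdef]; linarith
    linarith [Real.sin_pos_of_pos_of_lt_pi hlt h2, sbot a ha]
  have h0' : θ (a, c) ≤ -(Real.pi / 2) := by
    by_contra! hlt
    linarith [Real.cos_pos_of_mem_Ioo ⟨hlt, by linarith [h0.2]⟩, cleft c hc]
  have h1 : θ (b, c) ∈ Icc (0 - Real.pi) 0 :=
    angle_mem_Icc_of_sin_nonpos isPreconnected_Icc (hor c hc)
      (fun t ht => by simpa using sbot t ht) ha hb h0
  have h1' : -(Real.pi / 2) ≤ θ (b, c) := by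
    by_contra! hlt
    have := Real.cos_neg_of_pi_div_two_lt_of_lt (x := -θ (b, c)) (by linarith)
      (by linarith [h1.1])
    rw [Real.cos_neg] at this
    linarith [cright c hc]
  have h2 : θ (b, d) ∈ Icc (Real.pi / 2 - Real.pi) (Real.pi / 2) :=
    angle_mem_Icc_of_sin_nonpos isPreconnected_Icc (ver b hb)
      (fun t ht => by simpa [Real.sin_sub_pi_div_two] using cright t ht) hc hd
      ⟨by linarith, by linarith [h1.2]⟩
  have h2' : 0 ≤ θ (b, d) := by
    by_contra! hlt
    linarith [Real.sin_neg_of_neg_of_neg_pi_lt hlt (by linarith [h2.1]), snonneg_top b hb]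
  have h3 : θ (a, d) ∈ Icc (Real.pi - Real.pi) Real.pi :=
    angle_mem_Icc_of_sin_nonpos isPreconnected_Icc (hor d hd)
      (fun t ht => by simpa [Real.sin_sub_pi] using snonneg_top t ht) hb ha
      ⟨by linarith, by linarith [h2.2]⟩
  have h3' : Real.pi / 2 ≤ θ (a, d) := by
    by_contra! hlt
    linarith [Real.cos_pos_of_mem_Ioo ⟨by linarith [h3.1], hlt⟩, cleft d hd]
  have h4 : θ (a, c) ∈ Icc (3 * Real.pi / 2 - Real.pi) (3 * Real.pi / 2) := by
    refine angle_mem_Icc_of_sin_nonpos isPreconnected_Icc (ver a ha)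
      (fun t ht => ?_) hd hc ⟨by linarith, by linarith [h3.2]⟩
    have : θ (a, t) - 3 * Real.pi / 2 = θ (a, t) + Real.pi / 2 - 2 * Real.pi := by ring
    rw [this, Real.sin_sub_two_pi, Real.sin_add_pi_div_two]
    exact cleft t ht
  linarith [h4.1]

open Set in
/-- Brouwer's fixed-point theorem for a planar rectangle. -/
theorem exists_fixedPoint_of_mapsTo_rectangle {a b c d : ℝ} (hab : a ≤ b) (hcd : c ≤ d)
    {f : ℝ × ℝ → ℝ × ℝ} (hf : ContinuousOn f (Icc a b ×ˢ Icc c d))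
    (hmaps : MapsTo f (Icc a b ×ˢ Icc c d) (Icc a b ×ˢ Icc c d)) :
    ∃ p ∈ Icc a b ×ˢ Icc c d, f p = p := by
  have ha : a ∈ Icc a b := left_mem_Icc.2 hab
  have hb : b ∈ Icc a b := right_mem_Icc.2 hab
  have hc : c ∈ Icc c d := left_mem_Icc.2 hcd
  have hd : d ∈ Icc c d := right_mem_Icc.2 hcd
  obtain ⟨p, hp, h⟩ := exists_zero_of_boundary_signs hab hcd
    (g := fun p => Complex.equivRealProdCLM.symm (p - f p))
    (Complex.equivRealProdCLM.symm.continuous.comp_continuousOn (continuousOn_id.sub hf))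
    (fun y hy => by simpa using (hmaps (x := (a, y)) ⟨ha, hy⟩).1.1)
    (fun y hy => by simpa using (hmaps (x := (b, y)) ⟨hb, hy⟩).1.2)
    (fun x hx => by simpa using (hmaps (x := (x, c)) ⟨hx, hc⟩).2.1)
    (fun x hx => by simpa using (hmaps (x := (x, d)) ⟨hx, hd⟩).2.2)
  refine ⟨p, hp, ?_⟩
  rw [EmbeddingLike.map_eq_zero_iff, sub_eq_zero] at h
  exact h.symm

/-! ### Stationary distributions of finite chains with a reachable state -/

/-- A stochastic matrix on the finite set `S` for which the state `z` can be reached from every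
state. -/
structure IsChainWithReachableState {α : Type} (S : Finset α) (P : α → α → ℝ) (z : α) : Prop where
  mem : z ∈ S
  nonneg : ∀ x ∈ S, ∀ y ∈ S, 0 ≤ P x y
  row_sum : ∀ x ∈ S, ∑ y ∈ S, P x y = 1
  reach : ∀ x ∈ S, Relation.ReflTransGen (fun x y => x ∈ S ∧ y ∈ S ∧ 0 < P x y) x z

namespace IsChainWithReachableState

variable {α : Type} {S : Finset α} {P : α → α → ℝ} {z : α}

/-- By the balance equations, positive mass spreads along every transition of positive probability.
-/
theorem pos_of_balance (h : IsChainWithReachableState S P z) {v : α → ℝ}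
    (hv : ∀ x ∈ S, 0 ≤ v x) (hbal : ∀ y ∈ S, ∑ x ∈ S, v x * P x y = v y) {x : α} (hx : x ∈ S)
    (hpos : 0 < v x) : 0 < v z := by
  suffices ∀ y, Relation.ReflTransGen (fun x y => x ∈ S ∧ y ∈ S ∧ 0 < P x y) x y → 0 < v y from
    this z (h.reach x hx)
  intro y hxy
  induction hxy with
  | refl => exact hpos
  | tail _ hstep ih =>
    obtain ⟨hb, hc, hP⟩ := hstep
    rw [← hbal _ hc]
    exact Finset.sum_pos' (fun a ha => mul_nonneg (hv a ha) (h.nonneg a ha _ hc))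
      ⟨_, hb, mul_pos ih hP⟩

/-- The triangle inequality gives `≤` in each coordinate from `|v|` to its image; both sides have
the same total because the rows sum to one, so equality holds everywhere. -/
theorem abs_balance (h : IsChainWithReachableState S P z) {v : α → ℝ}
    (hbal : ∀ y ∈ S, ∑ x ∈ S, v x * P x y = v y) :
    ∀ y ∈ S, ∑ x ∈ S, |v x| * P x y = |v y| := by
  have hle : ∀ y ∈ S, |v y| ≤ ∑ x ∈ S, |v x| * P x y := fun y hy => by
    rw [← hbal y hy]
    refine (Finset.abs_sum_le_sum_abs _ _).trans_eq (Finset.sum_congr rfl fun x hx => ?_)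
    rw [abs_mul, abs_of_nonneg (h.nonneg x hx y hy)]
  have hsum : ∑ y ∈ S, |v y| = ∑ y ∈ S, ∑ x ∈ S, |v x| * P x y := by
    rw [Finset.sum_comm]
    refine Finset.sum_congr rfl fun x hx => ?_
    rw [← Finset.mul_sum, h.row_sum x hx, mul_one]
  exact fun y hy => ((Finset.sum_eq_sum_iff_of_le hle).1 hsum y hy).symm

/-- A nonzero `v` with sum zero takes both signs, so `|v| + v` and `|v| - v` are nonnegative,
nonzero and invariant. Both would be positive at `z`, but one of them vanishes there. -/
theorem eq_zero_of_balance (h : IsChainWithReachableState S P z) {v : α → ℝ}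
    (hbal : ∀ y ∈ S, ∑ x ∈ S, v x * P x y = v y) (hsum : ∑ x ∈ S, v x = 0) :
    ∀ x ∈ S, v x = 0 := by
  by_contra! hne
  have habs := h.abs_balance hbal
  obtain ⟨x, hx, hx0⟩ := Finset.exists_pos_of_sum_zero_of_exists_nonzero v hsum hne
  obtain ⟨y, hy, hy0⟩ := Finset.exists_pos_of_sum_zero_of_exists_nonzero
    (s := S) (fun x => - v x) (by simp [hsum]) (by simpa using hne)
  have h1 : 0 < |v z| + v z := h.pos_of_balance (v := fun x => |v x| + v x)
    (fun x _ => by linarith [neg_abs_le (v x)])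
    (fun y hy => by simp only [add_mul, Finset.sum_add_distrib, habs y hy, hbal y hy]) hx
    (by positivity)
  have h2 : 0 < |v z| - v z := h.pos_of_balance (v := fun x => |v x| - v x)
    (fun x _ => by linarith [le_abs_self (v x)])
    (fun y hy => by simp only [sub_mul, Finset.sum_sub_distrib, habs y hy, hbal y hy]) hy
    (by have := abs_nonneg (v y); linarith)
  rcases abs_cases (v z) with h3 | h3 <;> linarith

/-- With `M = ∑ |v|`, the invariant vector `|v| - M v` has sum zero, hence vanishes; as `M ≥ 1`,
this fixes the sign of `v`. -/
theorem nonneg_of_balance (h : IsChainWithReachableState S P z) {v : α → ℝ}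
    (hbal : ∀ y ∈ S, ∑ x ∈ S, v x * P x y = v y) (hsum : ∑ x ∈ S, v x = 1) :
    ∀ x ∈ S, 0 ≤ v x := by
  intro x hx
  have hM : 1 ≤ ∑ x ∈ S, |v x| := by
    rw [← hsum]
    exact Finset.sum_le_sum fun x _ => le_abs_self _
  have := h.eq_zero_of_balance (v := fun y => |v y| - (∑ x ∈ S, |v x|) * v y)
    (fun y hy => by
      simp only [sub_mul, Finset.sum_sub_distrib, h.abs_balance hbal y hy, mul_assoc,
        ← Finset.mul_sum, hbal y hy])
    (by rw [Finset.sum_sub_distrib, ← Finset.mul_sum, hsum, mul_one, sub_self]) x hx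
  have h2 : 0 ≤ (∑ x ∈ S, |v x|) * v x := by linarith [abs_nonneg (v x)]
  exact nonneg_of_mul_nonneg_right h2 (by linarith)

theorem isUniqueStationaryDist (h : IsChainWithReachableState S P z) {π : α → ℝ}
    (hπ : IsStationaryDist S P π) : IsUniqueStationaryDist S P π := by
  refine ⟨hπ, fun π₂ hπ₂ => funext fun x => ?_⟩
  by_cases hx : x ∈ S
  · have := h.eq_zero_of_balance (v := fun x => π₂ x - π x)
      (fun y hy => by
        simp only [sub_mul, Finset.sum_sub_distrib, hπ.balance y hy, hπ₂.balance y hy])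
      (by simp [hπ.sum_eq_one, hπ₂.sum_eq_one]) x hx
    exact sub_eq_zero.1 this
  · rw [hπ.eq_zero x hx, hπ₂.eq_zero x hx]

theorem stationary_pos (h : IsChainWithReachableState S P z) {π : α → ℝ}
    (hπ : IsStationaryDist S P π) : 0 < π z := by
  obtain ⟨x, hx, hx0⟩ : ∃ x ∈ S, 0 < π x := by
    by_contra! hle
    linarith [hπ.sum_eq_one, Finset.sum_nonpos hle]
  exact h.pos_of_balance hπ.nonneg hπ.balance hx hx0

/-- The stationary distribution depends continuously on the transition probabilities. -/
theorem exists_continuous_stationaryDist {T : Type*} [TopologicalSpace T] {P : T → α → α → ℝ}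
    (h : ∀ t, IsChainWithReachableState S (P t) z)
    (hP : ∀ x ∈ S, ∀ y ∈ S, Continuous fun t => P t x y) :
    ∃ π : T → α → ℝ, (∀ t, IsStationaryDist S (P t) (π t)) ∧ ∀ x, Continuous fun t => π t x := by
  classical
  -- `A` is the identity minus the transpose of `P`, plus the all-ones matrix. The entries of `A v`
  -- add up to `|S| ∑ v`. So `A v = 0` forces sum zero and balance, hence `v = 0`, and `A v = 1`
  -- forces sum one and balance. The solution is continuous in `t` since the inverse is the adjugate
  -- divided by the determinant.
  let A : T → Matrix S S ℝ := fun t => Matrix.of fun y x => (1 : Matrix S S ℝ) y x - P t x y + 1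
  have hA : ∀ t (v : S → ℝ) (y : S), (A t).mulVec v y = v y - ∑ x, v x * P t x y + ∑ x, v x := by
    intro t v y
    have : ∀ x : S, A t y x * v x = (1 : Matrix S S ℝ) y x * v x - v x * P t x y + v x := by
      intro x
      simp only [A, Matrix.of_apply]
      ring
    simp only [Matrix.mulVec, dotProduct, this, Finset.sum_add_distrib, Finset.sum_sub_distrib]
    simp [Matrix.one_apply]
  have hAsum : ∀ t (v : S → ℝ), ∑ y, (A t).mulVec v y = (S.card : ℝ) * ∑ x, v x := by
    intro t v
    have h1 : ∑ y : S, ∑ x : S, v x * P t x y = ∑ x, v x := by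
      rw [Finset.sum_comm]
      refine Finset.sum_congr rfl fun x _ => ?_
      rw [← Finset.mul_sum, Finset.sum_coe_sort S (fun y => P t x y), (h t).row_sum x x.2, mul_one]
    simp only [hA, Finset.sum_add_distrib, Finset.sum_sub_distrib, h1]
    simp
  have hcoe : ∀ (v : S → ℝ) (f : α → ℝ),
      ∑ x ∈ S, (if hx : x ∈ S then v ⟨x, hx⟩ else 0) * f x = ∑ x : S, v x * f x := by
    intro v f
    rw [← Finset.sum_coe_sort S]
    exact Finset.sum_congr rfl fun x _ => by rw [dif_pos x.2]
  have hcoe1 : ∀ v : S → ℝ,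
      ∑ x ∈ S, (if hx : x ∈ S then v ⟨x, hx⟩ else 0) = ∑ x : S, v x := by
    intro v
    simpa using hcoe v fun _ => 1
  have hdet : ∀ t, (A t).det ≠ 0 := by
    intro t h0
    obtain ⟨v, hv, hAv⟩ := Matrix.exists_mulVec_eq_zero_iff.2 h0
    have hcard : (S.card : ℝ) ≠ 0 := by
      exact_mod_cast (Finset.card_pos.2 ⟨z, (h t).mem⟩).ne'
    have hsum : ∑ x, v x = 0 := by
      have := hAsum t v
      rw [hAv] at this
      simpa [hcard] using this.symm
    refine hv (funext fun y => ?_)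
    have := (h t).eq_zero_of_balance (v := fun x => if hx : x ∈ S then v ⟨x, hx⟩ else 0)
      (fun y hy => by
        have h1 := hA t v ⟨y, hy⟩
        rw [hAv, hsum] at h1
        simp only [hcoe v fun x => P t x y, dif_pos hy]
        simp only [Pi.zero_apply] at h1
        linarith) (by rw [hcoe1, hsum]) y y.2
    simpa using this
  let w : T → S → ℝ := fun t => (A t)⁻¹.mulVec 1
  have hAw : ∀ t, (A t).mulVec (w t) = 1 := by
    intro t
    simp only [w, Matrix.mulVec_mulVec]
    rw [Matrix.mul_nonsing_inv _ (hdet t).isUnit, Matrix.one_mulVec]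
  have hwsum : ∀ t, ∑ x, w t x = 1 := by
    intro t
    have hcard : (S.card : ℝ) ≠ 0 := by
      exact_mod_cast (Finset.card_pos.2 ⟨z, (h t).mem⟩).ne'
    have := hAsum t (w t)
    rw [hAw] at this
    simpa [hcard, eq_comm] using this
  refine ⟨fun t x => if hx : x ∈ S then w t ⟨x, hx⟩ else 0, fun t => ?_, fun x => ?_⟩
  · have hbal : ∀ y ∈ S, ∑ x ∈ S, (if hx : x ∈ S then w t ⟨x, hx⟩ else 0) * P t x y =
        if hy : y ∈ S then w t ⟨y, hy⟩ else 0 := by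
      intro y hy
      have h1 := hA t (w t) ⟨y, hy⟩
      rw [hAw, hwsum] at h1
      simp only [hcoe (w t) fun x => P t x y, dif_pos hy]
      simp only [Pi.one_apply] at h1
      linarith
    have hsum := (hcoe1 (w t)).trans (hwsum t)
    exact ⟨(h t).nonneg_of_balance hbal hsum, fun x hx => dif_neg hx, hsum, hbal⟩
  · by_cases hx : x ∈ S
    · simp only [dif_pos hx]
      have hAc : Continuous A := by
        refine continuous_matrix fun y x => ?_
        exact (continuous_const.sub (hP x x.2 y y.2)).add continuous_const
      have hinv : Continuous fun t => (A t)⁻¹ := by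
        simp only [Matrix.inv_def, Ring.inverse_eq_inv']
        exact (hAc.matrix_det.inv₀ hdet).smul hAc.matrix_adjugate
      exact continuous_pi_iff.1 (hinv.matrix_mulVec continuous_const) ⟨x, hx⟩
    · simp only [dif_neg hx]
      exact continuous_const

end IsChainWithReachableState

/-! ### Backoff cycle averages -/

theorem one_sub_interruptProb {w : ℕ} (hw : 1 ≤ w) (r : ℝ) :
    1 - interruptProb w r = (1 / (w : ℝ)) * ∑ l ∈ Finset.Icc 1 w, r ^ (l - 1) := by
  have : (w : ℝ) ≠ 0 := by positivity
  simp only [interruptProb, Finset.sum_sub_distrib, Finset.sum_const, Nat.card_Icc, nsmul_eq_mul]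
  simp only [Nat.add_sub_cancel]
  field_simp
  ring

theorem sum_Icc_pow_pred (r : ℝ) (m : ℕ) :
    ∑ l ∈ Finset.Icc 1 m, r ^ (l - 1) = ∑ v ∈ Finset.range m, r ^ v := by
  induction m with
  | zero => simp
  | succ m ih =>
    rw [Finset.sum_Icc_succ_top (by omega), ih, Finset.sum_range_succ, Nat.add_sub_cancel]

/-- Tail-sum formula for the mean of the minimum of `l` and a geometric time: the count exceeds `v <
l` with probability `r ^ v`. -/
theorem meanFirst_eq (w : ℕ) (r : ℝ) :
    meanFirst w r = (1 / (w : ℝ)) * ∑ l ∈ Finset.Icc 1 w, ∑ v ∈ Finset.range l, r ^ v := by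
  have key : ∀ m : ℕ, ((m : ℝ) + 1) * r ^ m +
      ∑ v ∈ Finset.Icc 1 m, (v : ℝ) * r ^ (v - 1) * (1 - r) = ∑ v ∈ Finset.range (m + 1), r ^ v := by
    intro m
    induction m with
    | zero => simp
    | succ m ih =>
      rw [Finset.sum_Icc_succ_top (by omega), Finset.sum_range_succ, ← ih, Nat.add_sub_cancel]
      push_cast
      ring
  rw [meanFirst]
  congr 1
  refine Finset.sum_congr rfl fun l hl => ?_
  obtain ⟨m, rfl⟩ := Nat.exists_eq_add_of_le' (Finset.mem_Icc.1 hl).1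
  rw [← key, Nat.add_sub_cancel]
  push_cast
  ring

theorem one_sub_interruptProb_pos {w : ℕ} (hw : 1 ≤ w) {r : ℝ} (hr : 0 ≤ r) :
    0 < 1 - interruptProb w r := by
  rw [one_sub_interruptProb hw]
  have : (0 : ℝ) < w := by positivity
  refine mul_pos (by positivity) (Finset.sum_pos' (fun l _ => by positivity)
    ⟨1, Finset.mem_Icc.2 ⟨le_rfl, hw⟩, by simp⟩)

theorem one_sub_interruptProb_le_meanFirst {w : ℕ} (hw : 1 ≤ w) {r : ℝ} (hr : 0 ≤ r) :
    1 - interruptProb w r ≤ meanFirst w r := by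
  rw [one_sub_interruptProb hw, meanFirst_eq]
  refine mul_le_mul_of_nonneg_left (Finset.sum_le_sum fun l hl => ?_) (by positivity)
  refine Finset.single_le_sum (f := fun v => r ^ v) (fun v _ => by positivity) ?_
  have := (Finset.mem_Icc.1 hl).1
  exact Finset.mem_range.2 (by omega)

/-- Each inner geometric sum is at most the full one over `v < w`, which equals `w (1 - I)`. -/
theorem meanFirst_le {w : ℕ} (hw : 1 ≤ w) {r : ℝ} (hr : 0 ≤ r) :
    meanFirst w r ≤ w * (1 - interruptProb w r) := by
  rw [one_sub_interruptProb hw, meanFirst_eq, sum_Icc_pow_pred, mul_left_comm]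
  refine mul_le_mul_of_nonneg_left ?_ (by positivity)
  refine (Finset.sum_le_card_nsmul _ _ (∑ v ∈ Finset.range w, r ^ v) fun l hl => ?_).trans_eq
    (by simp)
  exact Finset.sum_le_sum_of_subset_of_nonneg
    (Finset.range_mono (Finset.mem_Icc.1 hl).2) fun v _ _ => by positivity

theorem meanFirst_pos {w : ℕ} (hw : 1 ≤ w) {r : ℝ} (hr : 0 ≤ r) : 0 < meanFirst w r :=
  (one_sub_interruptProb_pos hw hr).trans_le (one_sub_interruptProb_le_meanFirst hw hr)

/-- In this form `I` and `R` differ only by the weights `l - v`, which lie between 1 and `w`; the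
two bounds on `R` follow termwise. -/
theorem interruptProb_eq (w : ℕ) (r : ℝ) :
    interruptProb w r = (1 / (w : ℝ)) *
      ∑ l ∈ Finset.Icc 1 w, ∑ v ∈ Finset.Icc 1 (l - 1), r ^ (v - 1) * (1 - r) := by
  rw [interruptProb]
  congr 1
  refine Finset.sum_congr rfl fun l _ => ?_
  rw [← Finset.sum_mul, sum_Icc_pow_pred, geom_sum_mul_neg]

theorem interruptProb_nonneg (w : ℕ) {r : ℝ} (hr : 0 ≤ r) (hr1 : r ≤ 1) :
    0 ≤ interruptProb w r :=
  mul_nonneg (by positivity) (Finset.sum_nonneg fun _ _ => sub_nonneg.2 (pow_le_one₀ hr hr1))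

theorem interruptProb_pos {w : ℕ} (hw : 2 ≤ w) {r : ℝ} (hr : 0 ≤ r) (hr1 : r < 1) :
    0 < interruptProb w r := by
  have : (0 : ℝ) < w := by positivity
  refine mul_pos (by positivity) (Finset.sum_pos'
    (fun _ _ => sub_nonneg.2 (pow_le_one₀ hr hr1.le)) ⟨2, Finset.mem_Icc.2 ⟨by omega, hw⟩, ?_⟩)
  simpa using hr1

theorem interruptProb_le_meanResidual (w : ℕ) {r : ℝ} (hr : 0 ≤ r) (hr1 : r ≤ 1) :
    interruptProb w r ≤ meanResidual w r := by
  rw [interruptProb_eq, meanResidual]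
  refine mul_le_mul_of_nonneg_left (Finset.sum_le_sum fun l _ => Finset.sum_le_sum fun v hv => ?_)
    (by positivity)
  rw [mul_assoc]
  refine le_mul_of_one_le_left (mul_nonneg (by positivity) (sub_nonneg.2 hr1)) ?_
  have := Finset.mem_Icc.1 hv
  have h : v + 1 ≤ l := by omega
  have h' : (v : ℝ) + 1 ≤ l := by exact_mod_cast h
  linarith

theorem meanResidual_le (w : ℕ) {r : ℝ} (hr : 0 ≤ r) (hr1 : r ≤ 1) :
    meanResidual w r ≤ w * interruptProb w r := by
  rw [interruptProb_eq, meanResidual, mul_left_comm]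
  refine mul_le_mul_of_nonneg_left ?_ (by positivity)
  rw [Finset.mul_sum]
  refine Finset.sum_le_sum fun l hl => ?_
  rw [Finset.mul_sum]
  refine Finset.sum_le_sum fun v _ => ?_
  rw [mul_assoc]
  refine mul_le_mul_of_nonneg_right ?_ (mul_nonneg (by positivity) (sub_nonneg.2 hr1))
  have h' : (l : ℝ) ≤ w := by exact_mod_cast (Finset.mem_Icc.1 hl).2
  linarith [(Nat.cast_nonneg v : (0 : ℝ) ≤ v)]

theorem quietProb_nonneg (n : ℕ) {βd βc : ℝ} (hd : βd ≤ 1) (hc : βc ≤ 1) (a : ℕ) :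
    0 ≤ quietProb n βd βc a :=
  mul_nonneg (pow_nonneg (sub_nonneg.2 hc) _) (pow_nonneg (sub_nonneg.2 hd) _)

theorem quietProb_le_one (n : ℕ) {βd βc : ℝ} (hd : 0 ≤ βd) (hd1 : βd ≤ 1) (hc : 0 ≤ βc)
    (hc1 : βc ≤ 1) (a : ℕ) : quietProb n βd βc a ≤ 1 :=
  mul_le_one₀ (pow_le_one₀ (by linarith) (by linarith)) (pow_nonneg (by linarith) _)
    (pow_le_one₀ (by linarith) (by linarith))

theorem rateS_pos {W : ℕ → ℕ} (hW : 1 ≤ W 0) (n : ℕ) {βd : ℝ} (hd : βd ≤ 1) :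
    0 < rateS n W βd :=
  div_pos (one_sub_interruptProb_pos hW (pow_nonneg (sub_nonneg.2 hd) _))
    (meanFirst_pos hW (pow_nonneg (sub_nonneg.2 hd) _))

theorem rateS_le_one {W : ℕ → ℕ} (hW : 1 ≤ W 0) (n : ℕ) {βd : ℝ} (hd : βd ≤ 1) :
    rateS n W βd ≤ 1 :=
  (div_le_one (meanFirst_pos hW (pow_nonneg (sub_nonneg.2 hd) _))).2
    (one_sub_interruptProb_le_meanFirst hW (pow_nonneg (sub_nonneg.2 hd) _))

/-! ### One transmission cycle -/

section Countdown

variable {n K x : ℕ} {βx βd : ℝ}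

theorem jointProb_nonneg (hx0 : 0 ≤ βx) (hx1 : βx ≤ 1) (hd0 : 0 ≤ βd) (hd1 : βd ≤ 1) (y t : ℕ) :
    0 ≤ jointProb n x βx βd y t := by
  have h1 : 0 ≤ 1 - βx := by linarith
  have h2 : 0 ≤ 1 - βd := by linarith
  exact Finset.sum_nonneg fun p _ => by positivity

theorem jointProb_zero (t : ℕ) :
    jointProb n x βx βd 0 t = (1 - βx) ^ (t * x) * (1 - βd) ^ (t * (n - 1 - x)) := by
  rw [jointProb, Finset.sum_eq_single (0, 0)]
  · simp
  · rintro ⟨i, j⟩ hp hne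
    have := (Finset.mem_filter.1 hp).2
    simp only [Nat.add_eq_zero_iff] at this
    simp [this] at hne
  · intro h
    simp at h

theorem sum_binomial_attempt (β : ℝ) (m t : ℕ) :
    ∑ i ∈ Finset.range (m + 1), ((1 - β) ^ t * β) ^ i * (m.choose i : ℝ) *
      (1 - β) ^ ((t + 1) * (m - i)) = (1 - β) ^ (t * m) := by
  have h := add_pow β (1 - β) m
  rw [add_sub_cancel, one_pow] at h
  have h' : (1 - β) ^ (t * m) = (1 - β) ^ (t * m) *
      ∑ i ∈ Finset.range (m + 1), β ^ i * (1 - β) ^ (m - i) * (m.choose i : ℝ) := by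
    rw [← h, mul_one]
  rw [h', Finset.mul_sum]
  refine Finset.sum_congr rfl fun i hi => ?_
  obtain ⟨j, rfl⟩ := Nat.exists_eq_add_of_le (Nat.lt_succ_iff.1 (Finset.mem_range.1 hi))
  rw [Nat.add_sub_cancel_left]
  ring

/-- When the number of attempts in slot `t + 1` is left free, only the silence of the first `t`
slots remains; the double sum factors into two binomial expansions. -/
theorem sum_range_jointProb (hx : x ≤ n - 1) (t : ℕ) :
    ∑ y ∈ Finset.range (n - 1 + 1), jointProb n x βx βd y (t + 1) =
      (1 - βx) ^ (t * x) * (1 - βd) ^ (t * (n - 1 - x)) := by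
  simp only [jointProb]
  rw [Finset.sum_fiberwise_of_maps_to, Finset.sum_product, ← sum_binomial_attempt,
    ← sum_binomial_attempt, Finset.sum_mul_sum]
  · refine Finset.sum_congr rfl fun i _ => Finset.sum_congr rfl fun j _ => ?_
    simp only [Nat.add_sub_cancel]
    ring
  · rintro ⟨i, j⟩ h
    simp only [Finset.mem_product, Finset.mem_range] at h ⊢
    omega

/-- Removing the term `y = 0` leaves a difference of consecutive silence probabilities, which
telescopes over the slots. -/
theorem sum_Icc_jointProb (hx : x ≤ n - 1) (t : ℕ) :
    ∑ y ∈ Finset.Icc 1 (n - 1), jointProb n x βx βd y (t + 1) =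
      (1 - βx) ^ (t * x) * (1 - βd) ^ (t * (n - 1 - x)) -
        (1 - βx) ^ ((t + 1) * x) * (1 - βd) ^ ((t + 1) * (n - 1 - x)) := by
  rw [← sum_range_jointProb hx, ← jointProb_zero, eq_sub_iff_add_eq, Finset.sum_range_succ',
    Finset.range_eq_Ico, Finset.sum_Ico_add' (fun y => jointProb n x βx βd y (t + 1)),
    zero_add, Finset.Ico_add_one_right_eq_Icc]

/-- In slot 1, with everyone attempting, no factor `1 - β` survives, so positivity persists at rate
1. All reachability arguments rest on this event. -/
theorem jointProb_all_pos (hx : x ≤ n - 1) (hx0 : 0 < βx) (hx1 : βx ≤ 1) (hd0 : 0 < βd)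
    (hd1 : βd ≤ 1) : 0 < jointProb n x βx βd (n - 1) 1 := by
  have h1 : 0 ≤ 1 - βx := by linarith
  have h2 : 0 ≤ 1 - βd := by linarith
  refine Finset.sum_pos' (fun p _ => by positivity) ⟨(x, n - 1 - x), ?_, ?_⟩
  · simp only [Finset.mem_filter, Finset.mem_product, Finset.mem_range]
    omega
  · simp only [Nat.sub_self, pow_zero, one_mul, mul_zero, mul_one, Nat.choose_self, Nat.cast_one]
    positivity

theorem countdownProb_nonneg (hx0 : 0 ≤ βx) (hx1 : βx ≤ 1) (hd0 : 0 ≤ βd) (hd1 : βd ≤ 1)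
    (s l : ℕ) (y : ℕ × ℕ × ℕ) : 0 ≤ countdownProb n K x βx βd s l y := by
  obtain ⟨s₂, a₂, b₂⟩ := y
  have h1 : 0 ≤ 1 - βx := by linarith
  have h2 : 0 ≤ 1 - βd := by linarith
  simp only [countdownProb]
  split_ifs
  · positivity
  · exact jointProb_nonneg hx0 hx1 hd0 hd1 _ _
  · rfl
  · exact jointProb_nonneg hx0 hx1 hd0 hd1 _ _
  · rfl

theorem sum_countdownProb_stop (hn : 2 ≤ n) (hx : x ≤ n - 1) (s l : ℕ) :
    ∑ y ∈ cycleStates n K, countdownProb n K x βx βd s (l + 1) (y.1, y.2, 0) =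
      (1 - βx) ^ (l * x) * (1 - βd) ^ (l * (n - 1 - x)) := by
  -- The index `a` counts the others that attempt in the last slot; `a = 0` encodes success. The
  -- targets are distinct because a collision has at least two participants.
  rw [← Finset.sum_of_injOn (s := Finset.Icc 0 (n - 1))
    (f := fun a => if a = 0 then (1 - βd) ^ ((l + 1) * (n - 1 - x)) * (1 - βx) ^ ((l + 1) * x)
      else jointProb n x βx βd a (l + 1))
    (fun a => if a = 0 then (0, 1) else ((s + 1) % (K + 1), a + 1))]
  · rw [← Finset.add_sum_Ioc_eq_sum_Icc (Nat.zero_le _), if_pos rfl]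
    have : ∑ a ∈ Finset.Ioc 0 (n - 1), (if a = 0 then (1 - βd) ^ ((l + 1) * (n - 1 - x)) *
        (1 - βx) ^ ((l + 1) * x) else jointProb n x βx βd a (l + 1)) =
        ∑ a ∈ Finset.Icc 1 (n - 1), jointProb n x βx βd a (l + 1) := by
      refine Finset.sum_congr rfl fun a ha => if_neg ?_
      have := (Finset.mem_Ioc.1 ha).1
      omega
    rw [this, sum_Icc_jointProb hx]
    ring
  · intro a _ b _ h
    dsimp only at h
    split_ifs at h <;> simp_all
  · intro a ha
    have := (Finset.mem_Icc.1 (Finset.mem_coe.1 ha)).2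
    have hmod := Nat.mod_lt (s + 1) (Nat.add_one_pos K)
    simp only [cycleStates, Finset.coe_product, Set.mem_prod, Finset.mem_coe, Finset.mem_range,
      Finset.mem_Icc]
    split_ifs <;> simp <;> omega
  · rintro ⟨s₂, a₂⟩ hy hne
    simp only [countdownProb, if_true]
    rw [if_neg, if_neg]
    · rintro ⟨rfl, h2, h3⟩
      refine hne ⟨a₂ - 1, ?_, ?_⟩
      · simp only [Finset.coe_Icc, Set.mem_Icc]
        omega
      · simp only [show a₂ - 1 ≠ 0 by omega, if_false, show a₂ - 1 + 1 = a₂ by omega]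
    · rintro ⟨rfl, rfl⟩
      exact hne ⟨0, by simp, by simp⟩
  · intro a ha
    have := (Finset.mem_Icc.1 ha).2
    rcases Nat.eq_zero_or_pos a with rfl | hpos
    · simp [countdownProb]
    · simp only [hpos.ne', if_false, countdownProb, if_true]
      have h1 : ¬((s + 1) % (K + 1) = 0 ∧ a + 1 = 1) := by omega
      have h2 : 2 ≤ a + 1 ∧ a + 1 ≤ n := by omega
      simp only [if_neg h1, h2, and_self, if_true, Nat.add_sub_cancel]

theorem sum_countdownProb_interrupt {W : ℕ → ℕ} (hx : x ≤ n - 1) {s l : ℕ} (hs : s ≤ K)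
    (hmax : ∀ s ≤ K, W s ≤ W K) (hl : l + 1 ≤ W s) :
    ∑ z ∈ (auxStates n K W).filter (fun z => 0 < z.2.2), countdownProb n K x βx βd s (l + 1) z =
      1 - (1 - βx) ^ (l * x) * (1 - βd) ^ (l * (n - 1 - x)) := by
  rw [← Finset.sum_of_injOn (s := Finset.range l ×ˢ Finset.Icc 1 (n - 1))
    (f := fun p => jointProb n x βx βd p.2 (p.1 + 1)) (fun p => (s, p.2, l - p.1))]
  · rw [Finset.sum_product]
    simp only [sum_Icc_jointProb hx]
    rw [Finset.sum_range_sub']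
    simp
  · rintro ⟨t, a⟩ h ⟨t', a'⟩ h' heq
    simp only [Finset.coe_product, Set.mem_prod, Finset.mem_coe, Finset.mem_range] at h h'
    simp only [Prod.mk.injEq] at heq ⊢
    omega
  · rintro ⟨t, a⟩ h
    have := hmax s hs
    simp only [Finset.coe_product, Set.mem_prod, Finset.mem_coe, Finset.mem_range,
      Finset.mem_Icc] at h
    simp only [auxStates, Finset.coe_filter, Set.mem_ofPred_eq, Finset.mem_filter,
      Finset.mem_product, Finset.mem_range, Finset.mem_Icc]
    omega
  · rintro ⟨s₂, a₂, b₂⟩ hz hne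
    have hb : 0 < b₂ := (Finset.mem_filter.1 hz).2
    simp only [countdownProb, hb.ne', if_false]
    rw [if_neg]
    rintro ⟨rfl, h1, h2, h3⟩
    refine hne ⟨(l - b₂, a₂), ?_, ?_⟩
    · simp only [Finset.coe_product, Set.mem_prod, Finset.mem_coe, Finset.mem_range,
        Finset.mem_Icc]
      omega
    · simp only [Prod.mk.injEq, true_and]
      omega
  · rintro ⟨t, a⟩ h
    simp only [Finset.mem_product, Finset.mem_range, Finset.mem_Icc] at h
    have h1 : l - t ≠ 0 := by omega
    simp only [countdownProb, h1, if_false]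
    have h2 : 1 ≤ a ∧ a ≤ n - 1 ∧ l - t < l + 1 := by omega
    simp only [h2, and_self, if_true]
    congr 1
    omega

end Countdown

/-! ### Row sums and positive transitions of the auxiliary chain -/

/-- The standing assumptions: parameters of the system, and positive attempt rates. -/
structure IsAdmissible (n K : ℕ) (W : ℕ → ℕ) (βd βc : ℝ) : Prop where
  two_le : 2 ≤ n
  window_pos : ∀ s ≤ K, 1 ≤ W s
  window_le : ∀ s ≤ K, W s ≤ W K
  d_pos : 0 < βd
  d_le : βd ≤ 1
  c_pos : 0 < βc
  c_le : βc ≤ 1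

/-- The states of the auxiliary chain, together with the fictitious states `(s, 1, 0)`, `s ≥ 1`. -/
def IsExtendedState (n K : ℕ) (W : ℕ → ℕ) (x : ℕ × ℕ × ℕ) : Prop :=
  x.1 ≤ K ∧ 1 ≤ x.2.1 ∧ x.2.1 ≤ n ∧ (0 < x.2.2 → x.2.1 < n ∧ x.2.2 < W x.1)

theorem isExtendedState_of_mem_auxStates {n K : ℕ} {W : ℕ → ℕ} {x : ℕ × ℕ × ℕ}
    (hx : x ∈ auxStates n K W) : IsExtendedState n K W x := by
  simp only [auxStates, Finset.mem_filter, Finset.mem_product, Finset.mem_range,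
    Finset.mem_Icc] at hx
  exact ⟨by omega, by omega, by omega, hx.2.2⟩

theorem isExtendedState_of_mem_cycleStates {n K : ℕ} {W : ℕ → ℕ} {x : ℕ × ℕ}
    (hx : x ∈ cycleStates n K) : IsExtendedState n K W (x.1, x.2, 0) := by
  simp only [cycleStates, Finset.mem_product, Finset.mem_range, Finset.mem_Icc] at hx
  exact ⟨by simp only; omega, hx.2.1, hx.2.2, by simp⟩

/-- A sum over the auxiliary states splits into the states with and without residual backoff. -/
theorem sum_auxStates_eq {n K : ℕ} {W : ℕ → ℕ} {f : ℕ × ℕ × ℕ → ℝ}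
    (hf : ∀ s, s ≠ 0 → f (s, 1, 0) = 0) :
    ∑ x ∈ auxStates n K W, f x = ∑ y ∈ cycleStates n K, f (y.1, y.2, 0) +
      ∑ z ∈ (auxStates n K W).filter (fun z => 0 < z.2.2), f z := by
  rw [← Finset.sum_filter_add_sum_filter_not (auxStates n K W) (fun z => 0 < z.2.2), add_comm]
  congr 1
  refine Finset.sum_of_injOn (fun x => (x.1, x.2.1)) ?_ ?_ ?_ ?_
  · rintro ⟨s, a, b⟩ h ⟨s', a', b'⟩ h' heq
    simp only [Finset.coe_filter, Set.mem_ofPred_eq] at h h'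
    simp only [Prod.mk.injEq] at heq ⊢
    omega
  · rintro ⟨s, a, b⟩ h
    simp only [auxStates, Finset.coe_filter, Finset.mem_filter, Set.mem_ofPred_eq,
      Finset.mem_product, Finset.mem_range, Finset.mem_Icc] at h
    simp only [cycleStates, Finset.coe_product, Set.mem_prod, Finset.mem_coe, Finset.mem_range,
      Finset.mem_Icc]
    omega
  · rintro ⟨s, a⟩ h hne
    simp only [cycleStates, Finset.mem_product, Finset.mem_range, Finset.mem_Icc] at h
    by_cases h1 : a = 1 ∧ s ≠ 0
    · obtain ⟨rfl, h1⟩ := h1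
      exact hf s h1
    · refine absurd ⟨(s, a, 0), ?_, rfl⟩ hne
      simp only [auxStates, Finset.coe_filter, Finset.mem_filter, Set.mem_ofPred_eq,
        Finset.mem_product, Finset.mem_range, Finset.mem_Icc]
      omega
  · rintro ⟨s, a, b⟩ h
    have : b = 0 := by simpa using (Finset.mem_filter.1 h).2
    rw [this]

theorem reflTransGen_stage {α : Type} {r : α → α → Prop} {K : ℕ} {e : ℕ → α}
    (hr : ∀ s ≤ K, r (e s) (e ((s + 1) % (K + 1)))) {s : ℕ} (hs : s ≤ K) :
    Relation.ReflTransGen r (e s) (e K) := by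
  induction hs using Nat.decreasingInduction with
  | self => exact .refl
  | of_succ s hs ih =>
    refine .head ?_ ih
    simpa [Nat.mod_eq_of_lt (show s + 1 < K + 1 by omega)] using hr s hs.le

namespace IsAdmissible

variable {n K : ℕ} {W : ℕ → ℕ} {βd βc : ℝ}

theorem resumeRate_mem (h : IsAdmissible n K W βd βc) (a : ℕ) :
    0 < (if a = 1 then rateS n W βd else βc) ∧ (if a = 1 then rateS n W βd else βc) ≤ 1 := by
  have h0 := h.window_pos 0 (Nat.zero_le _)
  split_ifs
  · exact ⟨rateS_pos h0 n h.d_le, rateS_le_one h0 n h.d_le⟩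
  · exact ⟨h.c_pos, h.c_le⟩

theorem auxKernel_nonneg (h : IsAdmissible n K W βd βc) (x y : ℕ × ℕ × ℕ) :
    0 ≤ auxKernel n K W βd βc x y := by
  obtain ⟨s, a, b⟩ := x
  simp only [auxKernel]
  split_ifs with hb
  · exact mul_nonneg (by positivity) (Finset.sum_nonneg fun l _ =>
      countdownProb_nonneg h.c_pos.le h.c_le h.d_pos.le h.d_le _ _ _)
  all_goals
    have hr := h.resumeRate_mem a
    simp only [*, if_true, if_false] at hr
    exact countdownProb_nonneg hr.1.le hr.2 h.d_pos.le h.d_le _ _ _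

theorem auxKernel_row_sum (h : IsAdmissible n K W βd βc) {x : ℕ × ℕ × ℕ}
    (hx : IsExtendedState n K W x) :
    ∑ y ∈ cycleStates n K, auxKernel n K W βd βc x (y.1, y.2, 0) +
      ∑ z ∈ (auxStates n K W).filter (fun z => 0 < z.2.2), auxKernel n K W βd βc x z = 1 := by
  obtain ⟨s, a, b⟩ := x
  obtain ⟨hs, ha1, han, hb⟩ := hx
  simp only at hs ha1 han hb
  have hcount : ∀ (x l : ℕ) (βx : ℝ), x ≤ n - 1 → 1 ≤ l → l ≤ W s →
      ∑ y ∈ cycleStates n K, countdownProb n K x βx βd s l (y.1, y.2, 0) +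
      ∑ z ∈ (auxStates n K W).filter (fun z => 0 < z.2.2), countdownProb n K x βx βd s l z = 1 := by
    intro x l βx hx hl hlW
    obtain ⟨l, rfl⟩ := Nat.exists_eq_add_of_le' hl
    rw [sum_countdownProb_stop h.two_le hx, sum_countdownProb_interrupt hx hs h.window_le hlW]
    ring
  simp only [auxKernel]
  rcases Nat.eq_zero_or_pos b with rfl | hpos
  · have hW : (W s : ℝ) ≠ 0 := by
      have := h.window_pos s hs
      positivity
    simp only [if_true]
    rw [← Finset.mul_sum, ← Finset.mul_sum, ← mul_add, Finset.sum_comm,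
      Finset.sum_comm (s := Finset.filter _ _), ← Finset.sum_add_distrib,
      Finset.sum_congr rfl fun l hl => hcount (a - 1) l βc (by omega) (Finset.mem_Icc.1 hl).1
        (Finset.mem_Icc.1 hl).2]
    simp [hW]
  · simp only [hpos.ne', if_false]
    exact hcount a b _ (by have := (hb hpos).1; omega) hpos (hb hpos).2.le

/-- The tagged node attempts in slot 1, either by drawing backoff 1 or because `b = 1`, and all
others join it. -/
theorem auxKernel_collision_pos (h : IsAdmissible n K W βd βc) {s a b : ℕ}
    (hx : IsExtendedState n K W (s, a, b)) (hb : b ≤ 1) :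
    0 < auxKernel n K W βd βc (s, a, b) ((s + 1) % (K + 1), n, 0) := by
  obtain ⟨hs, ha1, han, hbs⟩ := hx
  simp only at hs ha1 han hbs
  have hn := h.two_le
  have hcount : ∀ (x : ℕ) (βx : ℝ), x ≤ n - 1 → 0 < βx → βx ≤ 1 →
      0 < countdownProb n K x βx βd s 1 ((s + 1) % (K + 1), n, 0) := by
    intro x βx hx h0 h1
    have hne : n ≠ 1 := by omega
    simp only [countdownProb, if_true, hne, and_false, if_false, hn, le_refl, and_self]
    exact jointProb_all_pos hx h0 h1 h.d_pos h.d_le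
  simp only [auxKernel]
  rcases Nat.eq_zero_or_pos b with rfl | hpos
  · have hW : (0 : ℝ) < W s := by
      have := h.window_pos s hs
      positivity
    simp only [if_true]
    refine mul_pos (by positivity) (Finset.sum_pos' (fun l _ =>
      countdownProb_nonneg h.c_pos.le h.c_le h.d_pos.le h.d_le _ _ _) ⟨1, ?_, ?_⟩)
    · exact Finset.mem_Icc.2 ⟨le_rfl, h.window_pos s hs⟩
    · exact hcount _ _ (by omega) h.c_pos h.c_le
  · obtain rfl : b = 1 := by omega
    simp only [one_ne_zero, if_false]
    exact hcount _ _ (by have := (hbs hpos).1; omega) (h.resumeRate_mem a).1 (h.resumeRate_mem a).2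

/-- All others attempt in slot 1, which lowers the residual backoff by exactly one. -/
theorem auxKernel_interrupt_pos (h : IsAdmissible n K W βd βc) {s a b : ℕ}
    (hx : IsExtendedState n K W (s, a, b + 2)) :
    0 < auxKernel n K W βd βc (s, a, b + 2) (s, n - 1, b + 1) := by
  have han : a < n := (hx.2.2.2 (by simp)).1
  have hn := h.two_le
  have h1 : 1 ≤ n - 1 ∧ b + 1 < b + 2 := by omega
  have h2 : b + 2 - (b + 1) = 1 := by omega
  simp only [auxKernel, countdownProb, Nat.add_eq_zero_iff, OfNat.ofNat_ne_zero, one_ne_zero,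
    and_false, if_false, h1, le_refl, and_self, if_true, h2]
  exact jointProb_all_pos (by omega) (h.resumeRate_mem a).1 (h.resumeRate_mem a).2 h.d_pos h.d_le

end IsAdmissible

/-! ### Finitely many interruptions, and passage to the backoff-cycle chain -/

section Vanishing

variable {n K : ℕ} {W : ℕ → ℕ} {βd βc : ℝ}

theorem auxKernel_eq_zero_of_le {x y : ℕ × ℕ × ℕ} (hx : 0 < x.2.2) (hxy : x.2.2 ≤ y.2.2) :
    auxKernel n K W βd βc x y = 0 := by
  obtain ⟨s, a, b⟩ := x
  obtain ⟨s', a', b'⟩ := y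
  simp only at hx hxy
  have h1 : b' ≠ 0 := by omega
  have h2 : ¬ b' < b := by omega
  simp only [auxKernel, countdownProb, hx.ne', h1, h2, and_false, if_false]

theorem auxKernel_success_stage {s : ℕ} (hs : s ≠ 0) (x : ℕ × ℕ × ℕ) :
    auxKernel n K W βd βc x (s, 1, 0) = 0 := by
  obtain ⟨s', a, b⟩ := x
  simp [auxKernel, countdownProb, hs]

/-- Each interruption strictly lowers a positive residual backoff, so fewer than `b` further
interruptions can follow. -/
theorem returnProb_eq_zero_of_le {k : ℕ} {x : ℕ × ℕ × ℕ} (hx : 0 < x.2.2) (hk : x.2.2 ≤ k)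
    (y : ℕ × ℕ) : returnProb n K W βd βc k x y = 0 := by
  induction k generalizing x with
  | zero => omega
  | succ k ih =>
    refine Finset.sum_eq_zero fun z hz => ?_
    rcases le_or_gt x.2.2 z.2.2 with hle | hlt
    · rw [auxKernel_eq_zero_of_le hx hle, zero_mul]
    · rw [ih (Finset.mem_filter.1 hz).2 (by omega), mul_zero]

theorem residual_lt_of_mem_auxStates (hmax : ∀ s ≤ K, W s ≤ W K) {z : ℕ × ℕ × ℕ}
    (hz : z ∈ auxStates n K W) (hpos : 0 < z.2.2) : z.2.2 < W K := by
  have h := isExtendedState_of_mem_auxStates hz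
  exact (h.2.2.2 hpos).2.trans_le (hmax _ h.1)

theorem returnProb_eq_zero_of_window (hpos : 1 ≤ W K) (hmax : ∀ s ≤ K, W s ≤ W K)
    (x : ℕ × ℕ × ℕ) (y : ℕ × ℕ) : returnProb n K W βd βc (W K) x y = 0 := by
  obtain ⟨m, hm⟩ := Nat.exists_eq_add_of_le' hpos
  rw [hm]
  refine Finset.sum_eq_zero fun z hz => ?_
  have hz := Finset.mem_filter.1 hz
  have := residual_lt_of_mem_auxStates hmax hz.1 hz.2
  rw [returnProb_eq_zero_of_le hz.2 (by omega), mul_zero]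

/-- Balance unrolled backwards `m` times: at each stage the mass on interrupted states in the
remainder is replaced by its own balance equation, while the mass on `b = 0` joins the first sum.
The remainder vanishes at `m = W K`. -/
theorem balance_returnProb {φ : ℕ × ℕ × ℕ → ℝ}
    (hφ : IsStationaryDist (auxStates n K W) (auxKernel n K W βd βc) φ) {y : ℕ × ℕ}
    (hy : y ∈ cycleStates n K) (m : ℕ) :
    φ (y.1, y.2, 0) = ∑ x ∈ cycleStates n K, φ (x.1, x.2, 0) *
        ∑ k ∈ Finset.range m, returnProb n K W βd βc k (x.1, x.2, 0) y +
      ∑ x ∈ auxStates n K W, φ x * returnProb n K W βd βc m x y := by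
  have hφ0 : ∀ s, s ≠ 0 → φ (s, 1, 0) = 0 := fun s hs => hφ.eq_zero _ (by
    simp [auxStates, hs])
  induction m with
  | zero =>
    simp only [Finset.range_zero, Finset.sum_empty, mul_zero, Finset.sum_const_zero, zero_add,
      returnProb]
    by_cases hy1 : y.2 = 1 ∧ y.1 ≠ 0
    · obtain ⟨s, a⟩ := y
      simp only at hy1
      obtain ⟨rfl, hs⟩ := hy1
      simp [hφ0 s hs, auxKernel_success_stage hs]
    · refine (hφ.balance _ ?_).symm
      simp only [cycleStates, auxStates, Finset.mem_filter, Finset.mem_product, Finset.mem_range,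
        Finset.mem_Icc] at hy ⊢
      omega
  | succ m ih =>
    rw [ih, sum_auxStates_eq (f := fun x => φ x * returnProb n K W βd βc m x y)
      (fun s hs => by rw [hφ0 s hs, zero_mul])]
    simp only [Finset.sum_range_succ, mul_add, Finset.sum_add_distrib, add_assoc]
    congr 2
    simp only [returnProb, Finset.mul_sum]
    rw [Finset.sum_comm]
    refine Finset.sum_congr rfl fun z hz => ?_
    rw [← hφ.balance z (Finset.mem_filter.1 hz).1, Finset.sum_mul]
    exact Finset.sum_congr rfl fun x _ => by ring

end Vanishing

namespace IsAdmissible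

variable {n K : ℕ} {W : ℕ → ℕ} {βd βc : ℝ}

theorem returnProb_nonneg (h : IsAdmissible n K W βd βc) (k : ℕ) (x : ℕ × ℕ × ℕ) (y : ℕ × ℕ) :
    0 ≤ returnProb n K W βd βc k x y := by
  induction k generalizing x with
  | zero => exact h.auxKernel_nonneg _ _
  | succ k ih => exact Finset.sum_nonneg fun z _ => mul_nonneg (h.auxKernel_nonneg _ _) (ih z)

/-- Induction on a bound `m` for the residual after the next step: conditioning on that step either
ends the cycle or lowers the bound. -/
theorem sum_returnProb (h : IsAdmissible n K W βd βc) (m : ℕ) {x : ℕ × ℕ × ℕ}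
    (hx : IsExtendedState n K W x)
    (hm : ∀ z ∈ auxStates n K W, 0 < z.2.2 → auxKernel n K W βd βc x z ≠ 0 → z.2.2 ≤ m) :
    ∑ k ∈ Finset.range (m + 1), ∑ y ∈ cycleStates n K, returnProb n K W βd βc k x y = 1 := by
  induction m generalizing x with
  | zero =>
    rw [← h.auxKernel_row_sum hx, Finset.sum_range_one]
    refine (add_eq_left.2 (Finset.sum_eq_zero fun z hz => ?_)).symm
    have hz := Finset.mem_filter.1 hz
    by_contra hne
    have := hm z hz.1 hz.2 hne
    omega
  | succ m ih =>
    rw [Finset.sum_range_succ', ← h.auxKernel_row_sum hx, add_comm]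
    congr 1
    simp only [returnProb]
    simp only [Finset.sum_comm (s := cycleStates n K), ← Finset.mul_sum]
    rw [Finset.sum_comm]
    refine Finset.sum_congr rfl fun z hz => ?_
    have hz := Finset.mem_filter.1 hz
    rw [← Finset.mul_sum]
    by_cases h0 : auxKernel n K W βd βc x z = 0
    · rw [h0, zero_mul]
    · rw [ih (isExtendedState_of_mem_auxStates hz.1), mul_one]
      intro z' _ hz'0 hne
      have := hm z hz.1 hz.2 h0
      by_contra! hlt
      exact hne (auxKernel_eq_zero_of_le hz.2 (by omega))

theorem cycleKernel_row_sum (h : IsAdmissible n K W βd βc) {x : ℕ × ℕ} (hx : x ∈ cycleStates n K) :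
    ∑ y ∈ cycleStates n K, cycleKernel n K W βd βc x y = 1 := by
  obtain ⟨m, hm⟩ := Nat.exists_eq_add_of_le' (h.window_pos K le_rfl)
  simp only [cycleKernel, hm]
  rw [Finset.sum_comm]
  refine h.sum_returnProb m (isExtendedState_of_mem_cycleStates hx) fun z hz hpos _ => ?_
  have := residual_lt_of_mem_auxStates h.window_le hz hpos
  omega

theorem mod_mem_cycleStates (h : IsAdmissible n K W βd βc) (s : ℕ) :
    (s % (K + 1), n) ∈ cycleStates n K := by
  have := h.two_le
  have := Nat.mod_lt s (Nat.add_one_pos K)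
  simp only [cycleStates, Finset.mem_product, Finset.mem_range, Finset.mem_Icc]
  omega

theorem mem_auxStates_all (h : IsAdmissible n K W βd βc) (s : ℕ) :
    (s % (K + 1), n, 0) ∈ auxStates n K W := by
  have := h.two_le
  have := Nat.mod_lt s (Nat.add_one_pos K)
  simp only [auxStates, Finset.mem_filter, Finset.mem_product, Finset.mem_range, Finset.mem_Icc]
  omega

theorem cycleKernel_collision_pos (h : IsAdmissible n K W βd βc) {x : ℕ × ℕ}
    (hx : x ∈ cycleStates n K) :
    0 < cycleKernel n K W βd βc x ((x.1 + 1) % (K + 1), n) := by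
  have h0 : 0 < W K := h.window_pos K le_rfl
  exact Finset.sum_pos' (fun k _ => h.returnProb_nonneg _ _ _) ⟨0, Finset.mem_range.2 h0,
    h.auxKernel_collision_pos (isExtendedState_of_mem_cycleStates hx) zero_le_one⟩

/-- Immediate collisions with all others lead from any pair, including the fictitious `(s, 1)`, to
`((s + 1) mod (K + 1), n)` and onward through the stages to `(K, n)`. -/
theorem cycle_chain (h : IsAdmissible n K W βd βc) :
    IsChainWithReachableState (cycleStates n K) (cycleKernel n K W βd βc) (K, n) where
  mem := by simpa [Nat.mod_eq_of_lt] using h.mod_mem_cycleStates K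
  nonneg x _ y _ := Finset.sum_nonneg fun k _ => h.returnProb_nonneg _ _ _
  row_sum x hx := h.cycleKernel_row_sum hx
  reach x hx := by
    have hmod : ∀ s ≤ K, s % (K + 1) = s := fun s hs => Nat.mod_eq_of_lt (by omega)
    have hmem : ∀ s ≤ K, (s, n) ∈ cycleStates n K := fun s hs => by
      simpa [hmod s hs] using h.mod_mem_cycleStates s
    refine .head ⟨hx, h.mod_mem_cycleStates _, h.cycleKernel_collision_pos hx⟩ ?_
    exact reflTransGen_stage (e := fun s => (s, n)) (fun s hs =>
      ⟨hmem s hs, h.mod_mem_cycleStates _, h.cycleKernel_collision_pos (hmem s hs)⟩)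
      (Nat.lt_succ_iff.1 (Nat.mod_lt _ (Nat.add_one_pos K)))

theorem aux_chain (h : IsAdmissible n K W βd βc) :
    IsChainWithReachableState (auxStates n K W) (auxKernel n K W βd βc) (K, n, 0) where
  mem := by simpa [Nat.mod_eq_of_lt] using h.mem_auxStates_all K
  nonneg x _ y _ := h.auxKernel_nonneg x y
  row_sum x hx := by
    rw [sum_auxStates_eq fun s hs => auxKernel_success_stage hs x]
    exact h.auxKernel_row_sum (isExtendedState_of_mem_auxStates hx)
  reach := by
    have hmod : ∀ s ≤ K, s % (K + 1) = s := fun s hs => Nat.mod_eq_of_lt (by omega)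
    have hmem : ∀ s ≤ K, (s, n, 0) ∈ auxStates n K W := fun s hs => by
      simpa [hmod s hs] using h.mem_auxStates_all s
    have hsmall : ∀ s a b, (s, a, b) ∈ auxStates n K W → b ≤ 1 →
        (s, a, b) ∈ auxStates n K W ∧ ((s + 1) % (K + 1), n, 0) ∈ auxStates n K W ∧
          0 < auxKernel n K W βd βc (s, a, b) ((s + 1) % (K + 1), n, 0) := fun s a b hx hb =>
      ⟨hx, h.mem_auxStates_all _,
        h.auxKernel_collision_pos (isExtendedState_of_mem_auxStates hx) hb⟩
    have hreach : ∀ s a b, (s, a, b) ∈ auxStates n K W → b ≤ 1 →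
        Relation.ReflTransGen (fun x y => x ∈ auxStates n K W ∧ y ∈ auxStates n K W ∧
          0 < auxKernel n K W βd βc x y) (s, a, b) (K, n, 0) := fun s a b hx hb =>
      .head (hsmall s a b hx hb) (reflTransGen_stage (e := fun s => (s, n, 0))
        (fun s hs => hsmall s n 0 (hmem s hs) zero_le_one)
        (Nat.lt_succ_iff.1 (Nat.mod_lt _ (Nat.add_one_pos K))))
    rintro ⟨s, a, b⟩ hx
    rcases b with _ | b
    · exact hreach s a 0 hx zero_le_one
    · induction b generalizing a with
      | zero => exact hreach s a 1 hx le_rfl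
      | succ b ih =>
        have hn := h.two_le
        have hnext : (s, n - 1, b + 1) ∈ auxStates n K W := by
          simp only [auxStates, Finset.mem_filter, Finset.mem_product, Finset.mem_range,
            Finset.mem_Icc] at hx ⊢
          omega
        exact .head ⟨hx, hnext, h.auxKernel_interrupt_pos (isExtendedState_of_mem_auxStates hx)⟩
          (ih (n - 1) hnext)

theorem sum_cycleStates_pos (h : IsAdmissible n K W βd βc) {φ : ℕ × ℕ × ℕ → ℝ}
    (hφ : IsStationaryDist (auxStates n K W) (auxKernel n K W βd βc) φ) :
    0 < ∑ y ∈ cycleStates n K, φ (y.1, y.2, 0) := by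
  refine Finset.sum_pos' (fun y _ => ?_) ⟨(K, n), h.cycle_chain.mem, h.aux_chain.stationary_pos hφ⟩
  by_cases hy : (y.1, y.2, 0) ∈ auxStates n K W
  · exact hφ.nonneg _ hy
  · exact (hφ.eq_zero _ hy).ge

/-- Conditioning the stationary distribution on an attempt of the tagged node. -/
theorem cycle_isStationaryDist (h : IsAdmissible n K W βd βc) {φ : ℕ × ℕ × ℕ → ℝ}
    (hφ : IsStationaryDist (auxStates n K W) (auxKernel n K W βd βc) φ) :
    IsStationaryDist (cycleStates n K) (cycleKernel n K W βd βc) fun x =>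
      if x ∈ cycleStates n K then
        φ (x.1, x.2, 0) / ∑ y ∈ cycleStates n K, φ (y.1, y.2, 0) else 0 := by
  have hpos := h.sum_cycleStates_pos hφ
  have hφ0 : ∀ s, s ≠ 0 → φ (s, 1, 0) = 0 := fun s hs => hφ.eq_zero _ (by
    simp [auxStates, hs])
  refine ⟨fun x hx => ?_, fun x hx => if_neg hx, ?_, fun y hy => ?_⟩
  · simp only [hx, if_true]
    refine div_nonneg ?_ hpos.le
    by_cases hx : (x.1, x.2, 0) ∈ auxStates n K W
    · exact hφ.nonneg _ hx
    · exact (hφ.eq_zero _ hx).ge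
  · rw [Finset.sum_congr rfl fun x hx => if_pos hx, ← Finset.sum_div, div_self hpos.ne']
  · rw [if_pos hy, balance_returnProb hφ hy (W K), Finset.sum_congr rfl fun x hx => by
      rw [if_pos hx, div_mul_eq_mul_div], ← Finset.sum_div]
    congr 1
    simp only [returnProb_eq_zero_of_window (h.window_pos K le_rfl) h.window_le, mul_zero,
      Finset.sum_const_zero, add_zero]
    rfl

end IsAdmissible

/-! ### Continuity in the attempt rates -/

section Continuity

variable {T : Type*} [TopologicalSpace T] {f g : T → ℝ}

theorem Continuous.interruptProb (hf : Continuous f) (w : ℕ) :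
    Continuous fun t => interruptProb w (f t) := by
  unfold _root_.interruptProb
  fun_prop

theorem Continuous.meanResidual (hf : Continuous f) (w : ℕ) :
    Continuous fun t => meanResidual w (f t) := by
  unfold _root_.meanResidual
  fun_prop

theorem Continuous.meanFirst (hf : Continuous f) (w : ℕ) :
    Continuous fun t => meanFirst w (f t) := by
  unfold _root_.meanFirst
  fun_prop

theorem Continuous.quietProb (hf : Continuous f) (hg : Continuous g) (n a : ℕ) :
    Continuous fun t => quietProb n (f t) (g t) a := by
  unfold _root_.quietProb
  fun_prop

theorem Continuous.rateS (hf : Continuous f) (hf1 : ∀ t, f t ≤ 1) (n : ℕ) {W : ℕ → ℕ}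
    (hW : 1 ≤ W 0) : Continuous fun t => rateS n W (f t) := by
  have hr : Continuous fun t => (1 - f t) ^ (n - 1) := by fun_prop
  exact (continuous_const.sub (hr.interruptProb _)).div (hr.meanFirst _)
    fun t => (meanFirst_pos hW (pow_nonneg (sub_nonneg.2 (hf1 t)) _)).ne'

theorem Continuous.countdownProb (hf : Continuous f) (hg : Continuous g) (n K x s l : ℕ)
    (y : ℕ × ℕ × ℕ) : Continuous fun t => countdownProb n K x (f t) (g t) s l y := by
  obtain ⟨s₂, a₂, b₂⟩ := y
  have hj : ∀ y t, Continuous fun u => jointProb n x (f u) (g u) y t := fun y t => by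
    unfold jointProb
    fun_prop
  simp only [_root_.countdownProb]
  split_ifs <;> first | exact hj _ _ | fun_prop

theorem Continuous.auxKernel (hf : Continuous f) (hf1 : ∀ t, f t ≤ 1) (hg : Continuous g)
    (n K : ℕ) {W : ℕ → ℕ} (hW : 1 ≤ W 0) (x y : ℕ × ℕ × ℕ) :
    Continuous fun t => auxKernel n K W (f t) (g t) x y := by
  obtain ⟨s, a, b⟩ := x
  simp only [_root_.auxKernel]
  split_ifs
  · exact continuous_const.mul (continuous_finsetSum _ fun l _ => hg.countdownProb hf _ _ _ _ _ _)
  · exact (hf.rateS hf1 n hW).countdownProb hf _ _ _ _ _ _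
  · exact hg.countdownProb hf _ _ _ _ _ _

end Continuity

/-! ### Invariance of the square and positive denominators -/

theorem weighted_ratio_mem_Icc {ι : Type*} {s : Finset ι} {ψ f g : ι → ℝ} {w : ℝ} (hw : 0 < w)
    (hψ : ∀ i ∈ s, 0 ≤ ψ i) (hfg : ∀ i ∈ s, f i ≤ g i) (hgf : ∀ i ∈ s, g i ≤ w * f i)
    (hpos : 0 < ∑ i ∈ s, ψ i * g i) :
    (∑ i ∈ s, ψ i * f i) / ∑ i ∈ s, ψ i * g i ∈ Set.Icc (1 / w) 1 := by
  constructor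
  · rw [div_le_div_iff₀ hw hpos, one_mul, Finset.sum_mul]
    refine Finset.sum_le_sum fun i hi => ?_
    rw [mul_assoc, mul_comm (f i)]
    exact mul_le_mul_of_nonneg_left (hgf i hi) (hψ i hi)
  · rw [div_le_one hpos]
    exact Finset.sum_le_sum fun i hi => mul_le_mul_of_nonneg_left (hfg i hi) (hψ i hi)

namespace IsAdmissible

variable {n K : ℕ} {W : ℕ → ℕ} {βd βc : ℝ}

theorem quietProb_mem (h : IsAdmissible n K W βd βc) (a : ℕ) :
    0 ≤ quietProb n βd βc a ∧ quietProb n βd βc a ≤ 1 :=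
  ⟨quietProb_nonneg n h.d_le h.c_le a,
    quietProb_le_one n h.d_pos.le h.d_le h.c_pos.le h.c_le a⟩

theorem window_of_mem (h : IsAdmissible n K W βd βc) {x : ℕ × ℕ} (hx : x ∈ cycleStates n K) :
    1 ≤ W x.1 ∧ (W x.1 : ℝ) ≤ W K := by
  have hs := (isExtendedState_of_mem_cycleStates (W := W) hx).1
  exact ⟨h.window_pos _ hs, by exact_mod_cast h.window_le _ hs⟩

theorem meanResidual_mem (h : IsAdmissible n K W βd βc) {x : ℕ × ℕ} (hx : x ∈ cycleStates n K) :
    interruptProb (W x.1) (quietProb n βd βc x.2) ≤ meanResidual (W x.1) (quietProb n βd βc x.2) ∧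
      meanResidual (W x.1) (quietProb n βd βc x.2) ≤
        W K * interruptProb (W x.1) (quietProb n βd βc x.2) := by
  obtain ⟨h0, h1⟩ := h.quietProb_mem x.2
  exact ⟨interruptProb_le_meanResidual _ h0 h1, (meanResidual_le _ h0 h1).trans
    (mul_le_mul_of_nonneg_right (h.window_of_mem hx).2 (interruptProb_nonneg _ h0 h1))⟩

theorem meanFirst_mem (h : IsAdmissible n K W βd βc) {x : ℕ × ℕ} (hx : x ∈ cycleStates n K) :
    1 - interruptProb (W x.1) (quietProb n βd βc x.2) ≤ meanFirst (W x.1) (quietProb n βd βc x.2) ∧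
      meanFirst (W x.1) (quietProb n βd βc x.2) ≤
        W K * (1 - interruptProb (W x.1) (quietProb n βd βc x.2)) := by
  have h0 := (h.quietProb_mem x.2).1
  obtain ⟨hw, hwK⟩ := h.window_of_mem hx
  exact ⟨one_sub_interruptProb_le_meanFirst hw h0, (meanFirst_le hw h0).trans
    (mul_le_mul_of_nonneg_right hwK (one_sub_interruptProb_pos hw h0).le)⟩

/-- The state `(K, n)` alone suffices: it has positive mass, its window is at least 2, and its quiet
probability `(1 - βc) ^ (n - 1)` is below 1, so interruption is possible. -/
theorem sum_meanResidual_pos (h : IsAdmissible n K W βd βc) (hWK : 2 ≤ W K) {ψ : ℕ × ℕ → ℝ}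
    (hψ : IsStationaryDist (cycleStates n K) (cycleKernel n K W βd βc) ψ) :
    0 < ∑ x ∈ cycleStates n K, ψ x * meanResidual (W x.1) (quietProb n βd βc x.2) := by
  have hr : quietProb n βd βc n < 1 := by
    have := h.two_le
    rw [quietProb, Nat.sub_self, pow_zero, mul_one]
    exact pow_lt_one₀ (by linarith [h.c_le]) (by linarith [h.c_pos]) (by omega)
  refine Finset.sum_pos' (fun x hx => mul_nonneg (hψ.nonneg x hx) ?_)
    ⟨(K, n), h.cycle_chain.mem, mul_pos (h.cycle_chain.stationary_pos hψ) ?_⟩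
  · obtain ⟨h0, h1⟩ := h.quietProb_mem x.2
    exact (interruptProb_nonneg _ h0 h1).trans (h.meanResidual_mem hx).1
  · exact (interruptProb_pos hWK (h.quietProb_mem n).1 hr).trans_le
      (h.meanResidual_mem h.cycle_chain.mem).1

theorem sum_meanFirst_pos (h : IsAdmissible n K W βd βc) {ψ : ℕ × ℕ → ℝ}
    (hψ : IsStationaryDist (cycleStates n K) (cycleKernel n K W βd βc) ψ) :
    0 < ∑ x ∈ (cycleStates n K).erase (0, 1),
      ψ x * meanFirst (W x.1) (quietProb n βd βc x.2) := by
  have hpos : ∀ x ∈ cycleStates n K, 0 < meanFirst (W x.1) (quietProb n βd βc x.2) :=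
    fun x hx => meanFirst_pos (h.window_of_mem hx).1 (h.quietProb_mem x.2).1
  have hn := h.two_le
  refine Finset.sum_pos' (fun x hx => ?_) ⟨(K, n), Finset.mem_erase.2 ⟨?_, h.cycle_chain.mem⟩,
    mul_pos (h.cycle_chain.stationary_pos hψ) (hpos _ h.cycle_chain.mem)⟩
  · have hx := (Finset.mem_erase.1 hx).2
    exact mul_nonneg (hψ.nonneg x hx) (hpos x hx).le
  · simp only [ne_eq, Prod.mk.injEq]
    omega

end IsAdmissible

theorem theorem1 (n K : ℕ) (W : ℕ → ℕ) (hn : 2 ≤ n)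
    (hW_pos : ∀ s ≤ K, 1 ≤ W s) (hW_max : ∀ s ≤ K, W s ≤ W K) (hW_K : 2 ≤ W K) :
    ∃ βd ∈ Set.Icc (1 / (W K : ℝ)) 1, ∃ βc ∈ Set.Icc (1 / (W K : ℝ)) 1,
      ∃ (φ : ℕ × ℕ × ℕ → ℝ) (ψ : ℕ × ℕ → ℝ), SolvesFixedPoint n K W βd βc φ ψ := by
  have hwK : (0 : ℝ) < W K := by positivity
  have hw1 : 1 / (W K : ℝ) ≤ 1 := by
    rw [div_le_one hwK]
    exact_mod_cast hW_pos K le_rfl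
  set I := Set.Icc (1 / (W K : ℝ)) 1
  have hadm : ∀ t : (I ×ˢ I : Set (ℝ × ℝ)), IsAdmissible n K W t.1.1 t.1.2 := fun t =>
    ⟨hn, hW_pos, hW_max, (by positivity : 0 < 1 / (W K : ℝ)).trans_le t.2.1.1, t.2.1.2,
      (by positivity : 0 < 1 / (W K : ℝ)).trans_le t.2.2.1, t.2.2.2⟩
  have hd : Continuous fun t : (I ×ˢ I : Set (ℝ × ℝ)) => t.1.1 := by fun_prop
  have hc : Continuous fun t : (I ×ˢ I : Set (ℝ × ℝ)) => t.1.2 := by fun_prop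
  obtain ⟨φ, hφ, hφc⟩ := IsChainWithReachableState.exists_continuous_stationaryDist
    (fun t => (hadm t).aux_chain) fun x _ y _ =>
      hd.auxKernel (fun t => (hadm t).d_le) hc n K (hW_pos 0 (Nat.zero_le _)) x y
  set ψ : (I ×ˢ I : Set (ℝ × ℝ)) → ℕ × ℕ → ℝ := fun t x =>
    if x ∈ cycleStates n K then
      φ t (x.1, x.2, 0) / ∑ y ∈ cycleStates n K, φ t (y.1, y.2, 0) else 0 with hψdef
  have hψ : ∀ t, IsStationaryDist (cycleStates n K) (cycleKernel n K W t.1.1 t.1.2) (ψ t) :=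
    fun t => (hadm t).cycle_isStationaryDist (hφ t)
  have hψc : ∀ x, Continuous fun t => ψ t x := fun x => by
    simp only [hψdef]
    split_ifs
    · exact (hφc _).div (continuous_finsetSum _ fun y _ => hφc _)
        fun t => ((hadm t).sum_cycleStates_pos (hφ t)).ne'
    · exact continuous_const
  have hq : ∀ a, Continuous fun t : (I ×ˢ I : Set (ℝ × ℝ)) => quietProb n t.1.1 t.1.2 a :=
    fun a => hd.quietProb hc n a
  have hposd := fun t => (hadm t).sum_meanResidual_pos hW_K (hψ t)
  have hposc := fun t => (hadm t).sum_meanFirst_pos (hψ t)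
  let D : (I ×ˢ I : Set (ℝ × ℝ)) → ℝ := fun t =>
    (∑ x ∈ cycleStates n K, ψ t x * interruptProb (W x.1) (quietProb n t.1.1 t.1.2 x.2)) /
      ∑ x ∈ cycleStates n K, ψ t x * meanResidual (W x.1) (quietProb n t.1.1 t.1.2 x.2)
  let C : (I ×ˢ I : Set (ℝ × ℝ)) → ℝ := fun t =>
    (∑ x ∈ (cycleStates n K).erase (0, 1),
        ψ t x * (1 - interruptProb (W x.1) (quietProb n t.1.1 t.1.2 x.2))) /
      ∑ x ∈ (cycleStates n K).erase (0, 1),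
        ψ t x * meanFirst (W x.1) (quietProb n t.1.1 t.1.2 x.2)
  have hD : Continuous D := Continuous.div
    (continuous_finsetSum _ fun x _ => (hψc x).mul ((hq _).interruptProb _))
    (continuous_finsetSum _ fun x _ => (hψc x).mul ((hq _).meanResidual _))
    fun t => (hposd t).ne'
  have hC : Continuous C := Continuous.div
    (continuous_finsetSum _ fun x _ =>
      (hψc x).mul (continuous_const.sub ((hq _).interruptProb _)))
    (continuous_finsetSum _ fun x _ => (hψc x).mul ((hq _).meanFirst _))
    fun t => (hposc t).ne'
  have hDmem : ∀ t, D t ∈ I := fun t => weighted_ratio_mem_Icc hwK (hψ t).nonneg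
    (fun x hx => ((hadm t).meanResidual_mem hx).1) (fun x hx => ((hadm t).meanResidual_mem hx).2)
    (hposd t)
  have hCmem : ∀ t, C t ∈ I := fun t => weighted_ratio_mem_Icc hwK
    (fun x hx => (hψ t).nonneg x (Finset.mem_erase.1 hx).2)
    (fun x hx => ((hadm t).meanFirst_mem (Finset.mem_erase.1 hx).2).1)
    (fun x hx => ((hadm t).meanFirst_mem (Finset.mem_erase.1 hx).2).2) (hposc t)
  classical
  obtain ⟨p, hp, hfix⟩ := exists_fixedPoint_of_mapsTo_rectangle hw1 hw1
    -- The rates are admissible only on the square, so the map lives on the subtype; its value `p`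
    -- elsewhere is arbitrary, as only continuity on the square is required.
    (f := fun p => if hp : p ∈ I ×ˢ I then (D ⟨p, hp⟩, C ⟨p, hp⟩) else p)
    (by
      rw [continuousOn_iff_continuous_domRestrict, Set.domRestrict_dite]
      exact hD.prodMk hC)
    (fun p (hp : p ∈ I ×ˢ I) => by
      simp only [dif_pos hp]
      exact ⟨hDmem _, hCmem _⟩)
  replace hp : p ∈ I ×ˢ I := hp
  simp only [dif_pos hp] at hfix
  exact ⟨p.1, hp.1, p.2, hp.2, φ ⟨p, hp⟩, ψ ⟨p, hp⟩,
    { aux_stationary := (hadm ⟨p, hp⟩).aux_chain.isUniqueStationaryDist (hφ _)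
      cycle_stationary := (hadm ⟨p, hp⟩).cycle_chain.isUniqueStationaryDist (hψ _)
      aux_pos := (hadm ⟨p, hp⟩).sum_cycleStates_pos (hφ _)
      cycle_eq := fun x hx => if_pos hx
      s_pos := meanFirst_pos (hW_pos 0 (Nat.zero_le _))
        (pow_nonneg (sub_nonneg.2 (hadm ⟨p, hp⟩).d_le) _)
      d_pos := hposd ⟨p, hp⟩
      d_eq := (congrArg Prod.fst hfix).symm
      c_pos := hposc ⟨p, hp⟩
      c_eq := (congrArg Prod.snd hfix).symm }⟩
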